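/- **Theorem (internal stability and localization of the distributed output-feedback algorithm).** *System.* Consider a network of finitely many interacting subsystems with global dynamics $$x(t+1)=Ax(t)+Bu(t)+w(t),\qquad y(t)=Cx(t)+v(t),$$ where every scalar component of $x$, $u$, $y$ belongs to one subsystem (for scalar subsystems there is one component of each kind per subsystem). Write $j\in\mathcal N^1_{\rm in}(i)$ if $j=i$ or some state or input of subsystem $j$ enters the update of a state of subsystem $i$ through a nonzero entry of $A$ or $B$, and $j\in\mathcal N^k_{\rm in}(i)$ if $j$ is connected to $i$ by at most $k$ such steps. A transfer matrix $\mathbf G=\sum_k z^{-k}G[k]$ is called *$d$-localized* if, for all $k$, the entry of $G[k]$ in a row owned by subsystem $i$ and a column owned by subsystem $j$ vanishes whenever $j\notin\mathcal N^d_{\rm in}(i)$. *Data of the algorithm.* For each state component $c$ let $(A^c_{\rm SF},B^c_{\rm SF},C^c_{\rm SF},K^c_{\rm SF})$ be real matrices with all eigenvalues of $A^c_{\rm SF}$ in the open unit disc, put $\mathbf\Phi^{\rm SF}_w(:,c)=(zI-A^c_{\rm SF})^{-1}B^c_{\rm SF}$, and let $\mathbf\Phi^{\rm SF}_{xw}(:,c)=C^c_{\rm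 SF}\mathbf\Phi^{\rm SF}_w(:,c)$, $\mathbf\Phi^{\rm SF}_{uw}(:,c)=K^c_{\rm SF}\mathbf\Phi^{\rm SF}_w(:,c)$. Let $\mathbf\Phi^{\rm KF}_{ew}$, $\mathbf\Phi^{\rm KF}_{ev}$ be strictly proper transfer matrices, each row of which is given by a realization whose state matrix has all its eigenvalues in the open unit disc. Assume that these maps are feasible for the state-feedback and the Kalman-filter system level synthesis problems (for instance, that they are optimal solutions of these problems): $$\begin{bmatrix} zI-A&-B\end{bmatrix}\begin{bmatrix}\mathbf\Phi^{\rm SF}_{xw}\\ \mathbf\Phi^{\rm SF}_{uw}\end{bmatrix}=I,\qquad \begin{bmatrix}\mathbf\Phi^{\rm KF}_{ew}&\mathbf\Phi^{\rm KF}_{ev}\end{bmatrix}\begin{bmatrix}zI-A\\-C\end{bmatrix}=I,$$ and that $\mathbf\Phi^{\rm SF}_{xw},\mathbf\Phi^{\rm SF}_{uw},\mathbf\Phi^{\rm KF}_{ew},\mathbf\Phi^{\rm KF}_{ev}$ are $d$-localized, where $d$ is the communication radius of the algorithm. *Algorithm.* All controller variables start at $0$. At each time $t=0,1,\dots$ the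 owner of each component computes the following, where every sum uses only values received from the indicated neighbourhood of that owner ($\mathcal N^d_{\rm in}$ in stages 1 and 3, $\mathcal N^1_{\rm in}$ in stages 2 and 4). 1. Advance the realizations of the rows of $\mathbf\Phi^{\rm KF}_{ew}$ and $\mathbf\Phi^{\rm KF}_{ev}$ by one step with the received parts of $\beta(t)$ and $y(t)$ as inputs, giving $\widehat w_a(t+1)$ and $\widehat v_a(t+1)$. 2. Set $\widetilde w(t)=\beta(t)+A\widehat w(t)-\widehat w(t+1)$ and $\widetilde v(t)=A\widehat v(t)-\widehat v(t+1)$. For each $c$ set $\lambda_c(t+1)=A^c_{\rm SF}\lambda_c(t)+B^c_{\rm SF}\widetilde w_c(t)$ and $\xi_c(t+1)=A^c_{\rm SF}\xi_c(t)+B^c_{\rm SF}\widetilde v_c(t)$, then $\widehat\alpha^{(c)}(t+1)=C^c_{\rm SF}\lambda_c(t+1)$, $\widehat\zeta^{(c)}(t+1)=C^c_{\rm SF}\xi_c(t+1)$, $\widehat\gamma^{(c)}(t+1)=K^c_{\rm SF}\lambda_c(t+1)$, $\widehat\theta^{(c)}(t)=K^c_{\rm SF}\xi_c(t)$. 3.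 Set $\alpha(t+1)=\widehat w(t+1)+\sum_c\widehat\alpha^{(c)}(t+1)$, $\gamma(t+1)=\sum_c\widehat\gamma^{(c)}(t+1)$, $\zeta(t+1)=\widehat v(t+1)+\sum_c\widehat\zeta^{(c)}(t+1)$, $\theta(t)=\sum_c\widehat\theta^{(c)}(t)$. 4. Set $\beta(t+1)=-A\alpha(t+1)-B\gamma(t+1)-\zeta(t+1)$ and apply $u(t)=\gamma(t+1)+\theta(t)$. *Conclusion.* The algorithm internally stabilizes the system: in the closed loop, the maps from additive perturbations entering at any signal (plant state, output, input, and every variable or internal state computed in stages 1–4) and from the initial plant state to all of these signals are stable, i.e. there are $c$ and $0\le\rho<1$ such that at every time $t$ the size of all signals is at most $c$ times the sum of the sizes of the past and present perturbations and of the initial state, each discounted by $\rho$ per elapsed time step. Moreover, whenever the maps $\mathbf\Phi^{\rm SF}_{xw},\mathbf\Phi^{\rm SF}_{uw},\mathbf\Phi^{\rm KF}_{ew},\mathbf\Phi^{\rm KF}_{ev}$ are $d'$-localized (in particular for $d'=d$), the closed-loop maps from $(w,v)$ to $(x,u)$ are $(2d'+2)$-localized. -/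

import Mathlib

noncomputable section

/-- A networked linear system `x(t+1) = A x(t) + B u(t) + w(t)`, `y(t) = C x(t) + v(t)`.
`N` is the set of subsystems (nodes); `X`, `U`, `Y` index the scalar state, input and output
components, and `nodeX`, `nodeU`, `nodeY` give the subsystem that owns a component.
Scalar subsystems are the case `X = U = Y = N` with identity ownership. -/
structure Network (N X U Y : Type*) where
  A : Matrix X X ℝ
  B : Matrix X U ℝ
  C : Matrix Y X ℝ
  nodeX : X → N
  nodeU : U → N
  nodeY : Y → N

namespace Network

variable {N X U Y : Type*} (S : Network N X U Y)

/-- A state or an input of subsystem `j` enters the dynamics of subsystem `i` in one time step. -/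
def Affects (j i : N) : Prop :=
  (∃ a b, S.nodeX a = i ∧ S.nodeX b = j ∧ S.A a b ≠ 0) ∨
  (∃ a b, S.nodeX a = i ∧ S.nodeU b = j ∧ S.B a b ≠ 0)

/-- The incoming neighbourhood of `i`: the subsystems at most `k` steps upstream of `i`
(`i` itself included). -/
def inNbr : ℕ → N → Set N
  | 0, i => {i}
  | k + 1, i => {j | ∃ l ∈ inNbr k i, j = l ∨ S.Affects j l}

/-- A system with convolution kernel `G`, whose rows and columns are owned by subsystems, is
`d`-localized: an input at subsystem `j` influences an output at subsystem `i` only if `j` is at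
most `d` steps upstream of `i`. -/
def Localized {R Q : Type*} (row : R → N) (col : Q → N) (d : ℕ) (G : ℕ → Matrix R Q ℝ) : Prop :=
  ∀ k r c, col c ∉ S.inNbr d (row r) → G k r c = 0

end Network

/-- The part of a signal that is received from the subsystems in `s`; the components owned by other
subsystems are not available and are read as `0`. -/
def received {N Q : Type*} (own : Q → N) (s : Set N) (f : Q → ℝ) : Q → ℝ :=
  Set.indicator (own ⁻¹' s) f

/-- All eigenvalues of the real matrix `M` lie in the open unit disc. -/
def IsSchurStable {m : ℕ} (M : Matrix (Fin m) (Fin m) ℝ) : Prop :=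
  ∀ z ∈ spectrum ℂ (M.map (algebraMap ℝ ℂ)), ‖z‖ < 1

/-- The realization attached to one column of the state-feedback maps: the state response is
`(z I - A)⁻¹ B` (output matrix `I`), and `C`, `K` read off the columns of the closed-loop
maps to the state and to the input from it. -/
structure SFColumn (X U : Type*) where
  dim : ℕ
  A : Matrix (Fin dim) (Fin dim) ℝ
  B : Fin dim → ℝ
  C : Matrix X (Fin dim) ℝ
  K : Matrix U (Fin dim) ℝ

/-- A strictly proper realization `C (z I - A)⁻¹ B` of one row of a Kalman-filter map. -/
structure KFRow (Q : Type*) where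
  dim : ℕ
  A : Matrix (Fin dim) (Fin dim) ℝ
  B : Matrix (Fin dim) Q ℝ
  C : Fin dim → ℝ

/-- The data from which the controller is built: a realization of every column of the
state-feedback maps, and of every row of the two Kalman-filter maps (from the process noise and
from the measurement noise to the estimation error). -/
structure ControllerData (X U Y : Type*) where
  sf : X → SFColumn X U
  ew : X → KFRow X
  ev : X → KFRow Y

namespace ControllerData

variable {X U Y : Type*} (K : ControllerData X U Y)

/-- Convolution kernel of the state-feedback map from the disturbance to the state. -/
def sfX : ℕ → Matrix X X ℝ
  | 0 => 0
  | k + 1 => Matrix.of fun a c => ((K.sf c).C.mulVec (((K.sf c).A ^ k).mulVec (K.sf c).B)) a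

/-- Convolution kernel of the state-feedback map from the disturbance to the input. -/
def sfU : ℕ → Matrix U X ℝ
  | 0 => 0
  | k + 1 => Matrix.of fun a c => ((K.sf c).K.mulVec (((K.sf c).A ^ k).mulVec (K.sf c).B)) a

/-- Convolution kernel of the Kalman-filter map from the process noise to the error. -/
def kfW : ℕ → Matrix X X ℝ
  | 0 => 0
  | k + 1 => Matrix.of fun a c => Matrix.vecMul (K.ew a).C ((K.ew a).A ^ k * (K.ew a).B) c

/-- Convolution kernel of the Kalman-filter map from the measurement noise to the error. -/
def kfV : ℕ → Matrix X Y ℝ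
  | 0 => 0
  | k + 1 => Matrix.of fun a c => Matrix.vecMul (K.ev a).C ((K.ev a).A ^ k * (K.ev a).B) c

/-- The realizations are stable. -/
def Stable : Prop :=
  (∀ c, IsSchurStable (K.sf c).A) ∧ (∀ a, IsSchurStable (K.ew a).A) ∧
    (∀ a, IsSchurStable (K.ev a).A)

/-- The four maps are `d`-localized. -/
def MapsLocalized {N : Type*} (S : Network N X U Y) (d : ℕ) : Prop :=
  S.Localized S.nodeX S.nodeX d K.sfX ∧ S.Localized S.nodeU S.nodeX d K.sfU ∧
    S.Localized S.nodeX S.nodeX d K.kfW ∧ S.Localized S.nodeX S.nodeY d K.kfV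

variable {N : Type*} [Fintype X] [DecidableEq X] [Fintype U] [Fintype Y]
  (S : Network N X U Y)

/-- The constraint of the state-feedback problem, `(z I - A) Φxw - B Φuw = I`, read off
coefficientwise at every power `z ^ (-k)`. -/
def SFFeasible : Prop :=
  ∀ k, K.sfX (k + 1) - S.A * K.sfX k - S.B * K.sfU k = if k = 0 then 1 else 0

/-- The constraint of the Kalman-filter problem, `Φew (z I - A) - Φev C = I`, read off
coefficientwise at every power `z ^ (-k)`. -/
def KFFeasible : Prop :=
  ∀ k, K.kfW (k + 1) - K.kfW k * S.A - K.kfV k * S.C = if k = 0 then 1 else 0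

end ControllerData

/-- The values of all signals of the closed loop that are assigned during one pass of the main loop
of the algorithm. In the pass for time `t` these are `y(t)`, `wTilde(t)`, `vTilde(t)`,
`thetaHat(t)`, `theta(t)`, `u(t)`, and the value at time `t + 1` of every other signal.
The states `p`, `q` belong to the Kalman-filter rows driven by `beta` and `y`; the states
`lam`, `xi` belong to the two copies of the state-feedback realization; `alphaHat c a` is the
contribution that is computed for column `c` and sent to component `a`, and likewise for
`gammaHat`, `zetaHat`, `thetaHat`. The same type holds one additive perturbation per signal. -/
structure Signals {X U Y : Type*} (K : ControllerData X U Y) where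
  y : Y → ℝ
  p : (a : X) → Fin (K.ew a).dim → ℝ
  q : (a : X) → Fin (K.ev a).dim → ℝ
  wHat : X → ℝ
  vHat : X → ℝ
  wTilde : X → ℝ
  vTilde : X → ℝ
  lam : (c : X) → Fin (K.sf c).dim → ℝ
  xi : (c : X) → Fin (K.sf c).dim → ℝ
  alphaHat : X → X → ℝ
  zetaHat : X → X → ℝ
  gammaHat : X → U → ℝ
  thetaHat : X → U → ℝ
  alpha : X → ℝ
  gamma : U → ℝ
  zeta : X → ℝ
  theta : U → ℝ
  beta : X → ℝ
  u : U → ℝ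
  x : X → ℝ

namespace Signals

variable {X U Y : Type*} {K : ControllerData X U Y}

/-- All signals zero. -/
protected def zero : Signals K where
  y := 0
  p := 0
  q := 0
  wHat := 0
  vHat := 0
  wTilde := 0
  vTilde := 0
  lam := 0
  xi := 0
  alphaHat := 0
  zetaHat := 0
  gammaHat := 0
  thetaHat := 0
  alpha := 0
  gamma := 0
  zeta := 0
  theta := 0
  beta := 0
  u := 0
  x := 0

/-- The size of a collection of signal values: the sum of the norms of all of them. -/
def size [Fintype X] [Fintype U] [Fintype Y] (s : Signals K) : ℝ :=
  ‖s.y‖ + ‖s.p‖ + ‖s.q‖ + ‖s.wHat‖ + ‖s.vHat‖ + ‖s.wTilde‖ + ‖s.vTilde‖ + ‖s.lam‖ + ‖s.xi‖ +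
    ‖s.alphaHat‖ + ‖s.zetaHat‖ + ‖s.gammaHat‖ + ‖s.thetaHat‖ + ‖s.alpha‖ + ‖s.gamma‖ +
    ‖s.zeta‖ + ‖s.theta‖ + ‖s.beta‖ + ‖s.u‖ + ‖s.x‖

end Signals

section ClosedLoop

variable {N X U Y : Type*} [Fintype X] [Fintype U] [Fintype Y]

/-- One pass of the main loop of the algorithm, in closed loop with the plant. Here `s` holds the
values assigned in the previous pass, `d` is the communication radius, and the perturbation
`δ` is added to the signals at their assignment; `δ.x` is the process noise `w(t)` and
`δ.y` is the measurement noise `v(t)`. -/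
def closedLoopStep (S : Network N X U Y) (K : ControllerData X U Y) (d : ℕ)
    (s δ : Signals K) : Signals K :=
  -- the subsystems at most `k` steps upstream of the owner of a state or input component
  let nbrX : ℕ → X → Set N := fun k a => S.inNbr k (S.nodeX a)
  let nbrU : ℕ → U → Set N := fun k a => S.inNbr k (S.nodeU a)
  -- observe the output
  let y := S.C.mulVec s.x + δ.y
  -- stage 1: local rows of the Kalman-filter maps
  let p := (fun a => (K.ew a).A.mulVec (s.p a) +
    (K.ew a).B.mulVec (received S.nodeX (nbrX d a) s.beta)) + δ.p
  let q := (fun a => (K.ev a).A.mulVec (s.q a) +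
    (K.ev a).B.mulVec (received S.nodeY (nbrX d a) y)) + δ.q
  let wHat := (fun a => (K.ew a).C ⬝ᵥ p a) + δ.wHat
  let vHat := (fun a => (K.ev a).C ⬝ᵥ q a) + δ.vHat
  -- stage 2: outgoing components, one column of the state-feedback maps at a time
  let wTilde := (fun a => s.beta a + S.A a ⬝ᵥ received S.nodeX (nbrX 1 a) s.wHat - wHat a)
    + δ.wTilde
  let vTilde := (fun a => S.A a ⬝ᵥ received S.nodeX (nbrX 1 a) s.vHat - vHat a) + δ.vTilde
  let lam := (fun c => (K.sf c).A.mulVec (s.lam c) + wTilde c • (K.sf c).B) + δ.lam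
  let xi := (fun c => (K.sf c).A.mulVec (s.xi c) + vTilde c • (K.sf c).B) + δ.xi
  let alphaHat := (fun c => (K.sf c).C.mulVec (lam c)) + δ.alphaHat
  let zetaHat := (fun c => (K.sf c).C.mulVec (xi c)) + δ.zetaHat
  let gammaHat := (fun c => (K.sf c).K.mulVec (lam c)) + δ.gammaHat
  let thetaHat := (fun c => (K.sf c).K.mulVec (s.xi c)) + δ.thetaHat
  -- stage 3: local elements, summed over the contributions that are received
  let alpha := (fun a => wHat a + ∑ c, received S.nodeX (nbrX d a) (fun c => alphaHat c a) c)
    + δ.alpha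
  let gamma := (fun a => ∑ c, received S.nodeX (nbrU d a) (fun c => gammaHat c a) c) + δ.gamma
  let zeta := (fun a => vHat a + ∑ c, received S.nodeX (nbrX d a) (fun c => zetaHat c a) c)
    + δ.zeta
  let theta := (fun a => ∑ c, received S.nodeX (nbrU d a) (fun c => thetaHat c a) c) + δ.theta
  -- stage 4: internal controller state and control action
  let beta := (fun a => -(S.A a ⬝ᵥ received S.nodeX (nbrX 1 a) alpha) -
    S.B a ⬝ᵥ received S.nodeU (nbrX 1 a) gamma - zeta a) + δ.beta
  let u := gamma + theta + δ.u
  -- the plant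
  let x := S.A.mulVec s.x + S.B.mulVec u + δ.x
  { y, p, q, wHat, vHat, wTilde, vTilde, lam, xi, alphaHat, zetaHat, gammaHat, thetaHat,
    alpha, gamma, zeta, theta, beta, u, x }

/-- The closed loop, started at the plant state `x0` with the controller initialized to zero.
`closedLoop S K d x0 δ t` holds the values assigned in the pass for time `t - 1`; in particular
its component `x` is the plant state at time `t`. -/
def closedLoop (S : Network N X U Y) (K : ControllerData X U Y) (d : ℕ)
    (x0 : X → ℝ) (δ : ℕ → Signals K) : ℕ → Signals K
  | 0 => { (Signals.zero : Signals K) with x := x0 }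
  | t + 1 => closedLoopStep S K d (closedLoop S K d x0 δ t) (δ t)

/-- Internal stability: the maps from perturbations entering at any signal of the plant or of the
controller, and from the initial state of the plant, to all signals of the plant and of the
controller are stable, that is, their kernels are bounded by a decaying exponential. -/
def InternallyStabilizes (S : Network N X U Y) (K : ControllerData X U Y) (d : ℕ) : Prop :=
  ∃ c ρ : ℝ, 0 ≤ ρ ∧ ρ < 1 ∧ ∀ (x0 : X → ℝ) (δ : ℕ → Signals K) (t : ℕ),
    (closedLoop S K d x0 δ t).size ≤
      c * (ρ ^ t * ‖x0‖ + ∑ s ∈ Finset.range t, ρ ^ (t - (s + 1)) * (δ s).size)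

/-- A unit impulse at time `0` in component `b` of the process noise. -/
def impulseW [DecidableEq X] (K : ControllerData X U Y) (b : X) : ℕ → Signals K
  | 0 => { (Signals.zero : Signals K) with x := Pi.single b 1 }
  | _ + 1 => Signals.zero

/-- A unit impulse at time `0` in component `b` of the measurement noise. -/
def impulseV [DecidableEq Y] (K : ControllerData X U Y) (b : Y) : ℕ → Signals K
  | 0 => { (Signals.zero : Signals K) with y := Pi.single b 1 }
  | _ + 1 => Signals.zero

variable [DecidableEq X] [DecidableEq Y]

/-- Kernel of the closed-loop map from the process noise to the state. -/
def clmXX (S : Network N X U Y) (K : ControllerData X U Y) (d k : ℕ) : Matrix X X ℝ :=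
  Matrix.of fun a b => (closedLoop S K d 0 (impulseW K b) k).x a

/-- Kernel of the closed-loop map from the measurement noise to the state. -/
def clmXY (S : Network N X U Y) (K : ControllerData X U Y) (d k : ℕ) : Matrix X Y ℝ :=
  Matrix.of fun a b => (closedLoop S K d 0 (impulseV K b) k).x a

/-- Kernel of the closed-loop map from the process noise to the control action; `u(k)` is assigned
in the pass for time `k`. -/
def clmUX (S : Network N X U Y) (K : ControllerData X U Y) (d k : ℕ) : Matrix U X ℝ :=
  Matrix.of fun a b => (closedLoop S K d 0 (impulseW K b) (k + 1)).u a

/-- Kernel of the closed-loop map from the measurement noise to the control action. -/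
def clmUY (S : Network N X U Y) (K : ControllerData X U Y) (d k : ℕ) : Matrix U Y ℝ :=
  Matrix.of fun a b => (closedLoop S K d 0 (impulseV K b) (k + 1)).u a

/-- The closed-loop maps from `(w, v)` to `(x, u)` achieved by the algorithm with communication
radius `d` are `l`-localized. -/
def ClosedLoopLocalized (S : Network N X U Y) (K : ControllerData X U Y) (d l : ℕ) : Prop :=
  S.Localized S.nodeX S.nodeX l (clmXX S K d) ∧ S.Localized S.nodeX S.nodeY l (clmXY S K d) ∧
    S.Localized S.nodeU S.nodeX l (clmUX S K d) ∧ S.Localized S.nodeU S.nodeY l (clmUY S K d)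

end ClosedLoop

end

/-!
In the frequency domain the closed loop is a linear system over `ℝ⟦z⁻¹⟧` whose coefficients are the
plant matrices and the four given maps. Since these maps are localized, evaluating them on the
received parts of their inputs is the same as evaluating them on the full signals, so the
communication pattern disappears from the equations (`series_row_output`, `series_column_sum`).

Put `r = w̃ + z⁻¹ ṽ` and `e = ŵ + z⁻¹ v̂`, where every signal is read off the values
`closedLoop S K d x0 δ t` at index `t`, so that `w̃`, `ṽ`, `θ` and `u` are one step late. The state-feedback constraint turns the definition of `β` into `e = -Ψx r` and
`z⁻¹ β = -z⁻¹ B u` with `u = Ψu r`, where `Ψx = z Φx` and `Ψu = z Φu` are the undelayed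
state-feedback maps; the Kalman-filter constraint turns the definition of `e` into `e = -z⁻¹ x`;
and then `r = z⁻¹ β + z⁻¹ A e - e` vanishes. These equations hold up to terms coming from the
initial values and the noises, and `loop_elimination` keeps track of these terms exactly. It is used
twice.

* *Stability.* A pass of the algorithm is a linear map on the finite-dimensional space of all
  signals, so by variation of constants it suffices that the powers of the unperturbed pass decay
  exponentially, for which it is enough that every unperturbed run tends to zero. For such a run
  all error terms are responses of stable realizations to their initial states, hence absolutely
  summable; the absolutely summable power series form a ring, so all signals are absolutely
  summable (`IsTrajectory.summable`).
* *Localization.* For a run that starts at zero only the noises remain, and the elimination yields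
  `x = Ψx (z⁻¹ w + z⁻¹ A g - g) + g` and `u = z⁻¹ Ψu (z⁻¹ w + z⁻¹ A g - g)` with
  `g = Φew w + Φev v` (`IsTrajectory.plant_response`). Localization radii add up under
  multiplication, and here they add up to at most `2 d' + 1`.
-/

/-! ### Powers of matrices and of linear maps -/

/-- By Gelfand's formula the powers of a Schur stable matrix decay exponentially; only the
absolute summability of their entries is needed. -/
theorem IsSchurStable.summable_pow {m : ℕ} {M : Matrix (Fin m) (Fin m) ℝ} (hM : IsSchurStable M)
    (i j : Fin m) : Summable fun k => ‖(M ^ k) i j‖ := by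
  let _ : NormedRing (Matrix (Fin m) (Fin m) ℂ) := Matrix.linftyOpNormedRing
  let _ : NormedAlgebra ℂ (Matrix (Fin m) (Fin m) ℂ) := Matrix.linftyOpNormedAlgebra
  have : Nonempty (Fin m) := ⟨i⟩
  have : CompleteSpace (Matrix (Fin m) (Fin m) ℂ) := FiniteDimensional.complete ℂ _
  set a : Matrix (Fin m) (Fin m) ℂ := M.map (algebraMap ℝ ℂ) with ha
  have h1 : spectralRadius ℂ a < (1 : NNReal) :=
    spectrum.spectralRadius_lt_of_forall_lt a fun z hz => by exact_mod_cast hM z hz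
  obtain ⟨r, hr1, hr2⟩ := exists_between h1
  have hr : r ≠ ⊤ := (hr2.trans ENNReal.coe_lt_top).ne
  lift r to NNReal using hr
  have h2 := (spectrum.pow_nnnorm_pow_one_div_tendsto_nhds_spectralRadius a).eventually_lt_const hr1
  have h3 : ∀ᶠ k : ℕ in Filter.atTop, ‖‖(M ^ k) i j‖‖ ≤ (r : ℝ) ^ k := by
    filter_upwards [h2, Filter.eventually_gt_atTop 0] with k hk hk0
    have hk' : (‖a ^ k‖₊ : ENNReal) ≤ (r : ENNReal) ^ k := by
      have := ENNReal.rpow_le_rpow hk.le (Nat.cast_nonneg (α := ℝ) k)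
      rwa [← ENNReal.rpow_mul, one_div, inv_mul_cancel₀ (by positivity), ENNReal.rpow_one,
        ENNReal.rpow_natCast] at this
    have hk2 : ‖a ^ k‖ ≤ (r : ℝ) ^ k := by exact_mod_cast hk'
    refine le_trans ?_ hk2
    have h4 : (a ^ k) i j = (((M ^ k) i j : ℝ) : ℂ) := by
      rw [ha, ← Matrix.map_pow]; rfl
    rw [norm_norm, ← Complex.norm_real, ← h4, Matrix.linfty_opNorm_def]
    have h5 : ‖(a ^ k) i j‖₊ ≤ ∑ j, ‖(a ^ k) i j‖₊ :=
      Finset.single_le_sum (f := fun j => ‖(a ^ k) i j‖₊) (fun _ _ => zero_le) (Finset.mem_univ j)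
    have h6 := Finset.le_sup (f := fun i => ∑ j, ‖(a ^ k) i j‖₊) (Finset.mem_univ i)
    exact_mod_cast h5.trans h6
  exact summable_of_isBigO_nat (summable_geometric_of_lt_one r.2 (by exact_mod_cast hr2))
    (Asymptotics.IsBigO.of_bound' (by
      filter_upwards [h3] with k hk
      exact hk.trans (le_abs_self _)))

/-- If all orbits of an operator on a finite-dimensional space tend to `0`, then its powers decay
exponentially: already some power has norm at most `1 / 2`. -/
theorem exists_norm_pow_le_of_tendsto_zero {V : Type*} [NormedAddCommGroup V] [NormedSpace ℝ V]
    [FiniteDimensional ℝ V] (M : V →L[ℝ] V)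
    (hM : ∀ v, Filter.Tendsto (fun t : ℕ => (M ^ t) v) Filter.atTop (nhds 0)) :
    ∃ c ρ : ℝ, 0 ≤ c ∧ 0 ≤ ρ ∧ ρ < 1 ∧ ∀ t : ℕ, ‖M ^ t‖ ≤ c * ρ ^ t := by
  obtain ⟨C, hC, hb⟩ := (Module.finBasis ℝ V).exists_opNorm_le (F := V)
  have h1 : ∀ᶠ t : ℕ in Filter.atTop, ∀ i, ‖(M ^ t) (Module.finBasis ℝ V i)‖ ≤ 1 / (2 * C) := by
    rw [Filter.eventually_all]
    intro i
    have := (hM (Module.finBasis ℝ V i)).norm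
    rw [norm_zero] at this
    exact this.eventually_le_const (by positivity)
  obtain ⟨T, hT, hT0⟩ := (h1.and (Filter.eventually_gt_atTop 0)).exists
  have hT2 : ‖M ^ T‖ ≤ 1 / 2 := by
    refine (hb (by positivity) hT).trans (le_of_eq ?_)
    field_simp
  have hT' : (1 : ℝ) ≤ T := by exact_mod_cast hT0
  -- Bernoulli's inequality provides a rate whose `T`-th power is at least `1 / 2`
  set ρ : ℝ := 1 + -(1 / (2 * T)) with hρ
  have hq : 1 / (2 * (T : ℝ)) ≤ 1 / 2 := by
    apply one_div_le_one_div_of_le <;> linarith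
  have hq0 : 0 < 1 / (2 * (T : ℝ)) := by positivity
  have hρ0 : 0 < ρ := by rw [hρ]; linarith
  have hρT : 1 / 2 ≤ ρ ^ T := by
    refine le_trans (le_of_eq ?_) (one_add_mul_le_pow (by linarith) T)
    field_simp; norm_num
  set c : ℝ := ∑ r ∈ Finset.range T, ‖M ^ r‖ / ρ ^ r with hc
  have hc0 : 0 ≤ c := Finset.sum_nonneg fun r _ => by positivity
  refine ⟨c, ρ, hc0, hρ0.le, by rw [hρ]; linarith, fun t => ?_⟩
  induction t using Nat.strong_induction_on with
  | _ t ih =>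
    by_cases ht : t < T
    · have := Finset.single_le_sum (f := fun r => ‖M ^ r‖ / ρ ^ r)
        (fun r _ => by positivity) (Finset.mem_range.2 ht)
      rwa [← hc, div_le_iff₀ (by positivity)] at this
    · obtain ⟨s, rfl⟩ := Nat.exists_eq_add_of_le (not_lt.1 ht)
      rw [pow_add]
      calc ‖M ^ T * M ^ s‖ ≤ ‖M ^ T‖ * ‖M ^ s‖ := norm_mul_le _ _
        _ ≤ ρ ^ T * (c * ρ ^ s) :=
          mul_le_mul (hT2.trans hρT) (ih s (by omega)) (norm_nonneg _) (by positivity)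
        _ = c * ρ ^ (T + s) := by rw [pow_add]; ring

/-! ### Signals and kernels as power series -/

/-- The unit delay `z⁻¹`. -/
local notation "𝕫" => (PowerSeries.X : PowerSeries ℝ)

/-- The `z`-transform of a vector-valued signal; the power series variable is the unit delay
`z⁻¹`. -/
def series {ι : Type*} (f : ℕ → ι → ℝ) : ι → PowerSeries ℝ :=
  fun i => PowerSeries.mk fun t => f t i

/-- The transfer matrix of a convolution kernel. -/
def transfer {ι κ : Type*} (G : ℕ → Matrix ι κ ℝ) : Matrix ι κ (PowerSeries ℝ) :=
  Matrix.of fun r c => PowerSeries.mk fun k => G k r c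

/-- A signal that is nonzero at time `0` only. -/
noncomputable def atZero {ι : Type*} (v : ι → ℝ) : ι → PowerSeries ℝ := fun i => PowerSeries.C (v i)

/-- A real matrix as a transfer matrix without dynamics. -/
noncomputable abbrev gain {ι κ : Type*} (M : Matrix ι κ ℝ) : Matrix ι κ (PowerSeries ℝ) :=
  M.map PowerSeries.C

@[simp] theorem atZero_zero {ι : Type*} : atZero (0 : ι → ℝ) = 0 := by
  ext1 i; simp [atZero]

theorem series_add {ι : Type*} (f g : ℕ → ι → ℝ) :
    series (fun t => f t + g t) = series f + series g := by
  ext i t; simp [series]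

theorem series_sub {ι : Type*} (f g : ℕ → ι → ℝ) :
    series (fun t => f t - g t) = series f - series g := by
  ext i t; simp [series]

theorem series_neg {ι : Type*} (f : ℕ → ι → ℝ) :
    series (fun t => - f t) = - series f := by
  ext i t; simp [series]

theorem series_mulVec {ι κ : Type*} [Fintype κ] (M : Matrix ι κ ℝ) (f : ℕ → κ → ℝ) :
    series (fun t => M.mulVec (f t)) = (gain M).mulVec (series f) := by
  ext i t; simp [series, Matrix.mulVec, dotProduct, map_sum, PowerSeries.coeff_C_mul]

theorem series_of_succ {ι : Type*} {f g : ℕ → ι → ℝ} (h : ∀ t, f (t + 1) = g t) :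
    series f = 𝕫 • series g + atZero (f 0) := by
  ext i t
  cases t with
  | zero => simp [series, atZero]
  | succ t => simp [series, atZero, PowerSeries.coeff_succ_X_mul, h]

theorem series_zero {ι : Type*} : series (fun _ => (0 : ι → ℝ)) = 0 := by
  ext; simp [series]

theorem transfer_eq_X_smul {ι κ : Type*} {G : ℕ → Matrix ι κ ℝ} (h : G 0 = 0) :
    transfer G = 𝕫 • transfer fun k => G (k + 1) := by
  ext i j t
  cases t with
  | zero => simp [transfer, h]
  | succ t => simp [transfer, PowerSeries.coeff_succ_X_mul]

theorem X_smul_cancel {ι : Type*} {f g : ι → PowerSeries ℝ} (h : 𝕫 • f = 𝕫 • g) : f = g :=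
  funext fun i => PowerSeries.X_mul_cancel (congrFun h i)

/-- The resolvent `(I - z⁻¹ A)⁻¹ = ∑ₖ z⁻ᵏ Aᵏ`. -/
noncomputable def resolventSeries {m : ℕ} (A : Matrix (Fin m) (Fin m) ℝ) :
    Matrix (Fin m) (Fin m) (PowerSeries ℝ) :=
  transfer fun k => A ^ k

theorem resolvent_mul {m : ℕ} (A : Matrix (Fin m) (Fin m) ℝ) :
    resolventSeries A = 1 + 𝕫 • (resolventSeries A * gain A) := by
  ext i j t
  cases t with
  | zero => simp [resolventSeries, transfer, Matrix.one_apply, apply_ite]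
  | succ t =>
    simp [resolventSeries, transfer, Matrix.one_apply, apply_ite, PowerSeries.coeff_succ_X_mul,
      Matrix.mul_apply, map_sum, pow_succ, PowerSeries.coeff_mul_C, PowerSeries.coeff_one]

/-- The solution of a linear recursion. -/
theorem series_of_recursion {m : ℕ} (A : Matrix (Fin m) (Fin m) ℝ) {n g : ℕ → Fin m → ℝ}
    (h : ∀ t, n (t + 1) = A.mulVec (n t) + g t) :
    series n = (resolventSeries A).mulVec (𝕫 • series g + atZero (n 0)) := by
  have h1 := series_of_succ h
  rw [series_add, series_mulVec] at h1
  have h2 : (resolventSeries A).mulVec (series n) = series n +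
      𝕫 • (resolventSeries A).mulVec ((gain A).mulVec (series n)) := by
    conv_lhs => rw [resolvent_mul]
    rw [Matrix.add_mulVec, Matrix.one_mulVec, Matrix.smul_mulVec, Matrix.mulVec_mulVec]
  have h3 := congrArg (resolventSeries A).mulVec h1
  rw [h2] at h3
  simp only [smul_add, Matrix.mulVec_add, Matrix.mulVec_smul] at h3 ⊢
  rw [add_comm, add_assoc] at h3
  exact add_left_cancel h3

/-- The transfer function `C (I - z⁻¹ A)⁻¹ B` of a realization has the coefficients `C Aᵏ B`. -/
theorem dotProduct_resolvent_mulVec {m : ℕ} (A : Matrix (Fin m) (Fin m) ℝ) (b c : Fin m → ℝ) :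
    atZero c ⬝ᵥ (resolventSeries A).mulVec (atZero b) =
      PowerSeries.mk fun k => c ⬝ᵥ (A ^ k).mulVec b := by
  ext k
  simp [dotProduct, Matrix.mulVec, atZero, resolventSeries, transfer, map_sum,
    PowerSeries.coeff_C_mul, PowerSeries.coeff_mul_C]

/-! ### Absolutely summable power series -/

/-- The power series with absolutely summable coefficients, that is, the stable signals and
transfer functions. -/
def SummableSeries (f : PowerSeries ℝ) : Prop := Summable fun k => ‖PowerSeries.coeff k f‖

namespace SummableSeries

variable {f g : PowerSeries ℝ}

theorem add (hf : SummableSeries f) (hg : SummableSeries g) : SummableSeries (f + g) :=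
  Summable.of_nonneg_of_le (fun _ => norm_nonneg _)
    (fun k => by rw [map_add]; exact norm_add_le _ _) (Summable.add hf hg)

theorem neg (hf : SummableSeries f) : SummableSeries (-f) := by
  simpa only [SummableSeries, map_neg, norm_neg] using hf

theorem zero : SummableSeries 0 := by
  simpa only [SummableSeries, map_zero, norm_zero] using summable_zero

theorem mul (hf : SummableSeries f) (hg : SummableSeries g) : SummableSeries (f * g) := by
  simp only [SummableSeries, PowerSeries.coeff_mul]
  exact summable_norm_sum_mul_antidiagonal_of_summable_norm
    (f := fun k => PowerSeries.coeff k f) (g := fun k => PowerSeries.coeff k g) hf hg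

theorem sum {ι : Type*} {s : Finset ι} {f : ι → PowerSeries ℝ}
    (hf : ∀ i ∈ s, SummableSeries (f i)) : SummableSeries (∑ i ∈ s, f i) :=
  Finset.sum_induction f SummableSeries (fun _ _ => add) zero hf

theorem of_C (a : ℝ) : SummableSeries (PowerSeries.C a) := by
  refine summable_of_ne_finset_zero (s := {0}) fun k hk => ?_
  simp only [Finset.mem_singleton] at hk
  simp [PowerSeries.coeff_C, hk]

theorem X_mul_iff : SummableSeries (PowerSeries.X * f) ↔ SummableSeries f := by
  rw [SummableSeries, ← summable_nat_add_iff 1]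
  simp only [PowerSeries.coeff_succ_X_mul, SummableSeries]

end SummableSeries

/-- The vectors of absolutely summable power series. -/
def SummableVec {ι : Type*} (f : ι → PowerSeries ℝ) : Prop := ∀ i, SummableSeries (f i)

namespace SummableVec

variable {ι κ : Type*} {f g : ι → PowerSeries ℝ}

theorem add (hf : SummableVec f) (hg : SummableVec g) : SummableVec (f + g) :=
  fun i => (hf i).add (hg i)

theorem sub (hf : SummableVec f) (hg : SummableVec g) : SummableVec (f - g) :=
  fun i => by rw [sub_eq_add_neg]; exact (hf i).add (hg i).neg

theorem neg (hf : SummableVec f) : SummableVec (-f) :=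
  fun i => (hf i).neg

theorem X_smul_iff : SummableVec (𝕫 • f) ↔ SummableVec f :=
  forall_congr' fun _ => SummableSeries.X_mul_iff

theorem X_smul (hf : SummableVec f) : SummableVec (𝕫 • f) :=
  X_smul_iff.2 hf

theorem of_atZero (v : ι → ℝ) : SummableVec (atZero v) := fun i => SummableSeries.of_C (v i)

theorem dotProduct [Fintype ι] (hf : SummableVec f) (hg : SummableVec g) :
    SummableSeries (f ⬝ᵥ g) :=
  SummableSeries.sum fun i _ => (hf i).mul (hg i)

theorem mulVec [Fintype ι] {M : Matrix κ ι (PowerSeries ℝ)} (hM : ∀ i, SummableVec (M i))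
    (hf : SummableVec f) : SummableVec (M.mulVec f) :=
  fun i => (hM i).dotProduct hf

theorem gain_mulVec [Fintype ι] (M : Matrix κ ι ℝ) (hf : SummableVec f) :
    SummableVec ((gain M).mulVec f) :=
  mulVec (fun _ _ => SummableSeries.of_C _) hf

theorem resolvent_mulVec {m : ℕ} {A : Matrix (Fin m) (Fin m) ℝ} (hA : IsSchurStable A)
    {f : Fin m → PowerSeries ℝ} (hf : SummableVec f) : SummableVec ((resolventSeries A).mulVec f) :=
  mulVec (fun i j => by
    simpa [SummableSeries, resolventSeries, transfer] using hA.summable_pow i j) hf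

theorem tendsto_zero {F : ℕ → ι → ℝ} [Finite ι] (hF : SummableVec (series F)) :
    Filter.Tendsto F Filter.atTop (nhds 0) := by
  rw [tendsto_pi_nhds]
  intro i
  have h : Summable fun t => PowerSeries.coeff t (series F i) := (hF i).of_norm
  simpa [series] using h.tendsto_atTop_zero

end SummableVec

/-! ### Elimination of the internal signals -/

/-- The algebraic core of the argument. The loop equations are read over any commutative ring with
a distinguished element `z` (the unit delay), every equation having its own error term. Eliminating
all signals but `r = w̃ + z ṽ` expresses `r` through the errors alone, `u` and `x` through `r` and
the errors, and `β` through `u` and the errors. The maps `Ψx`, `Ψu` and `W` are the state-feedback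
maps and the Kalman-filter map from the process noise, each with its delay removed; `VC` is the
Kalman-filter map from the measurement noise, composed with the output matrix. -/
theorem loop_elimination {R MX MU : Type*} [CommRing R] [AddCommGroup MX] [Module R MX]
    [AddCommGroup MU] [Module R MU] {z : R}
    {A Ψx W VC : MX →ₗ[R] MX} {B : MU →ₗ[R] MX} {Ψu : MX →ₗ[R] MU}
    (hΨ : ∀ m, Ψx m = m + z • A (Ψx m) + z • B (Ψu m))
    (hW : ∀ m, W m = m + z • W (A m) + VC m)
    {wh vh wt vt al ze be x e1 e2 e3 e4 e5 e7 e11 : MX} {ga th u e6 e8 : MU}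
    (h1 : wh = z • W be + e1) (h2 : vh = VC x + e2)
    (h3 : wt = z • be + z • A wh - wh + e3) (h4 : vt = z • A vh - vh + e4)
    (h5 : al = wh + Ψx wt + e5) (h6 : ga = Ψu wt + e6) (h7 : ze = vh + Ψx vt + e7)
    (h8 : th = z • Ψu vt + e8) (h9 : be = -A al - B ga - ze) (h10 : u = ga + th)
    (h11 : x = z • A x + B u + e11)
    {ee er eb ex r : MX} (hee : ee = e3 - z • (e7 + A e5 + B e6)) (her : er = e3 + z • e4)
    (heb : eb = z • B (e6 + e8) + ee - z • A ee - er)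
    (hex : ex = z • W e11 + W eb + e1 + z • e2)
    (hr : r = z • e11 + eb + z • A ex - ex + er) :
    wt + z • vt = r ∧ u = Ψu r + (e6 + e8) ∧ z • x = Ψx r - ee + ex ∧ z • be = -(z • B u) + eb := by
  set q := wt + z • vt with hq
  set e := wh + z • vh with he
  have hu : u = Ψu q + (e6 + e8) := by
    rw [h10, h6, h8, hq, map_add, map_smul]; module
  have hqe : q = z • be + z • A e - e + er := by
    rw [hq, he, her, h4, map_add, map_smul]
    linear_combination (norm := module) h3
  have hee' : e = -Ψx q + ee := by
    have hA := congrArg A h5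
    have hB := congrArg B h6
    simp only [map_add] at hA hB
    have hΨw := hΨ wt
    rw [hq, he, hee, map_add, map_smul]
    linear_combination (norm := module) h3 + z • h9 - z • hA - z • hB - z • h7 + hΨw
  have hzb : z • be = -(z • B u) + eb := by
    have hA := congrArg A hee'
    have hB := congrArg B hu
    have hΨq := hΨ q
    rw [heb]
    simp only [map_add, map_neg] at hA hB ⊢
    linear_combination (norm := module) -hqe + hee' - z • hA + z • hB - hΨq
  have hzx : e = -(z • x) + ex := by
    have hWb := congrArg W hzb
    have hWx := congrArg (fun m => z • W m) h11
    have hWW := hW x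
    rw [he, hex]
    simp only [map_add, map_neg, map_smul] at hWb hWx ⊢
    linear_combination (norm := module) h1 + z • h2 + hWb + hWx - z • hWW
  have hqr : q = r := by
    have hA := congrArg A hzx
    simp only [map_add, map_neg, map_smul] at hA
    rw [hr]
    linear_combination (norm := module) hqe + hzb + z • hA - hzx + z • h11
  rw [hqr] at hu hee'
  exact ⟨hqr, hu, by linear_combination (norm := module) hzx - hee', hzb⟩

/-! ### Realizations driven by the received signals -/

namespace Network

variable {N X U Y : Type*} (S : Network N X U Y)

theorem mem_inNbr_one_of_A {a b : X} (h : S.A a b ≠ 0) : S.nodeX b ∈ S.inNbr 1 (S.nodeX a) :=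
  ⟨S.nodeX a, rfl, Or.inr (Or.inl ⟨a, b, rfl, rfl, h⟩)⟩

theorem mem_inNbr_one_of_B {a : X} {b : U} (h : S.B a b ≠ 0) :
    S.nodeU b ∈ S.inNbr 1 (S.nodeX a) :=
  ⟨S.nodeX a, rfl, Or.inr (Or.inr ⟨a, b, rfl, rfl, h⟩)⟩

/-- Neighbourhoods compose along paths. -/
theorem mem_inNbr_add {a b : ℕ} {i j l : N} (hl : l ∈ S.inNbr a i) (hj : j ∈ S.inNbr b l) :
    j ∈ S.inNbr (a + b) i := by
  induction b generalizing j with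
  | zero => rw [show j = l from hj]; exact hl
  | succ b ih =>
    obtain ⟨m, hm, h⟩ := hj
    exact ⟨m, ih hm, h⟩

theorem inNbr_mono {a b : ℕ} (h : a ≤ b) (i : N) : S.inNbr a i ⊆ S.inNbr b i := by
  induction h with
  | refl => exact subset_rfl
  | step _ ih => exact fun j hj => ⟨j, ih hj, Or.inl rfl⟩

theorem A_dotProduct_received [Fintype X] (a : X) (f : X → ℝ) :
    S.A a ⬝ᵥ received S.nodeX (S.inNbr 1 (S.nodeX a)) f = S.A.mulVec f a := by
  refine Finset.sum_congr rfl fun b _ => ?_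
  by_cases hb : S.nodeX b ∈ S.inNbr 1 (S.nodeX a)
  · rw [received, Set.indicator_of_mem (by exact hb)]
  · have h : S.A a b = 0 := not_imp_comm.1 S.mem_inNbr_one_of_A hb
    simp [h]

theorem B_dotProduct_received [Fintype U] (a : X) (f : U → ℝ) :
    S.B a ⬝ᵥ received S.nodeU (S.inNbr 1 (S.nodeX a)) f = S.B.mulVec f a := by
  refine Finset.sum_congr rfl fun b _ => ?_
  by_cases hb : S.nodeU b ∈ S.inNbr 1 (S.nodeX a)
  · rw [received, Set.indicator_of_mem (by exact hb)]
  · have h : S.B a b = 0 := not_imp_comm.1 S.mem_inNbr_one_of_B hb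
    simp [h]

end Network

/-- The response of the rows of a Kalman-filter map to the initial states of their
realizations. -/
noncomputable def rowResponse {X Q : Type*} (F : X → KFRow Q) (n : (a : X) → Fin (F a).dim → ℝ) :
    X → PowerSeries ℝ :=
  fun a => atZero (F a).C ⬝ᵥ (resolventSeries (F a).A).mulVec (atZero (n a))

theorem rowResponse_zero {X Q : Type*} (F : X → KFRow Q) : rowResponse F 0 = 0 := by
  ext1 a; simp [rowResponse]

theorem SummableVec.rowResponse {X Q : Type*} {F : X → KFRow Q}
    (hF : ∀ a, IsSchurStable (F a).A) (n : (a : X) → Fin (F a).dim → ℝ) :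
    SummableVec (rowResponse F n) :=
  fun a => (SummableVec.of_atZero _).dotProduct
    (SummableVec.resolvent_mulVec (hF a) (SummableVec.of_atZero _))

/-- The rows of a localized Kalman-filter map may be driven by the received part of the input only:
the omitted inputs do not reach the output, even if they would reach the state of the
realization. -/
theorem series_row_output {N X U Y Q : Type*} [Fintype Q] (S : Network N X U Y) {d : ℕ}
    (own : Q → N) (F : X → KFRow Q) {G : ℕ → Matrix X Q ℝ}
    (hG : ∀ k a c, G k a c = Matrix.vecMul (F a).C ((F a).A ^ k * (F a).B) c)
    (hloc : S.Localized S.nodeX own d G)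
    {n : ℕ → (a : X) → Fin (F a).dim → ℝ} {g : ℕ → Q → ℝ} {f : ℕ → X → ℝ}
    (hn : ∀ t a, n (t + 1) a = (F a).A.mulVec (n t a) +
      (F a).B.mulVec (received own (S.inNbr d (S.nodeX a)) (g t)))
    (hf : ∀ t, f t = fun a => (F a).C ⬝ᵥ n t a) :
    series f = 𝕫 • (transfer G).mulVec (series g) +
      rowResponse F (n 0) := by
  ext1 a
  have h1 := series_of_recursion (F a).A (n := fun t => n t a) (fun t => hn t a)
  have h2 : series f a = atZero (F a).C ⬝ᵥ series (fun t => n t a) := by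
    ext t
    simp [series, hf, dotProduct, atZero, map_sum, PowerSeries.coeff_C_mul]
  have h3 : atZero (F a).C ⬝ᵥ (resolventSeries (F a).A).mulVec ((gain (F a).B).mulVec
      (series fun t => received own (S.inNbr d (S.nodeX a)) (g t))) =
      (transfer G).mulVec (series g) a := by
    rw [Matrix.mulVec_mulVec, Matrix.dotProduct_mulVec]
    refine Finset.sum_congr rfl fun c _ => ?_
    have h4 : Matrix.vecMul (atZero (F a).C) (resolventSeries (F a).A * gain (F a).B) c =
        transfer G a c := by
      have h5 := dotProduct_resolvent_mulVec (F a).A (fun i => (F a).B i c) (F a).C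
      refine Eq.trans ?_ (h5.trans ?_)
      · rfl
      · simp only [transfer, Matrix.of_apply, hG]
        rfl
    rw [h4]
    by_cases hc : own c ∈ S.inNbr d (S.nodeX a)
    · congr 1
      ext t
      simp only [series, received, PowerSeries.coeff_mk]
      exact Set.indicator_of_mem (s := own ⁻¹' _) hc (g t)
    · have h6 : transfer G a c = 0 := by
        ext k
        simpa [transfer] using hloc k a c hc
      simp [h6]
  rw [h2, h1, Matrix.mulVec_add, dotProduct_add, Matrix.mulVec_smul, dotProduct_smul,
    series_mulVec, h3]
  rfl

section Columns

variable {N X U Y Q : Type*} [Fintype X] (S : Network N X U Y) (d : ℕ)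
  (F : X → SFColumn X U) (own : Q → N) (out : (c : X) → Matrix Q (Fin (F c).dim) ℝ)

/-- The response, at the receivers, of the columns of a state-feedback map to the initial states of
their realizations. -/
noncomputable def columnResponse (n : (c : X) → Fin (F c).dim → ℝ) : Q → PowerSeries ℝ :=
  fun a => ∑ c, Set.indicator (S.nodeX ⁻¹' S.inNbr d (own a))
    (fun c => (gain (out c)).mulVec ((resolventSeries (F c).A).mulVec (atZero (n c))) a) c

theorem columnResponse_zero : columnResponse S d F own out 0 = 0 := by
  ext1 a
  refine Finset.sum_eq_zero fun c _ => ?_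
  simp

theorem SummableVec.columnResponse (hF : ∀ c, IsSchurStable (F c).A)
    (n : (c : X) → Fin (F c).dim → ℝ) : SummableVec (columnResponse S d F own out n) := by
  intro a
  refine SummableSeries.sum fun c _ => ?_
  by_cases hc : c ∈ S.nodeX ⁻¹' S.inNbr d (own a)
  · rw [Set.indicator_of_mem hc]
    exact (SummableVec.resolvent_mulVec (hF c) (SummableVec.of_atZero _)).gain_mulVec _ a
  · rw [Set.indicator_of_notMem hc]
    exact SummableSeries.zero

variable {F}

omit [Fintype X] in
/-- The state of a column is driven by the current input `g (t + 1)`, not by the previous one, so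
there is no delay and the initial input `g 0`, which never enters, has to be subtracted. -/
theorem series_column_state {n : ℕ → (c : X) → Fin (F c).dim → ℝ} {g : ℕ → X → ℝ}
    (hn : ∀ t c, n (t + 1) c = (F c).A.mulVec (n t c) + g (t + 1) c • (F c).B) (c : X) :
    series (fun t => n t c) = (resolventSeries (F c).A).mulVec
      (series g c • atZero (F c).B + atZero (n 0 c - g 0 c • (F c).B)) := by
  rw [series_of_recursion (F c).A (n := fun t => n t c) (fun t => hn t c)]
  congr 1
  ext i t
  cases t with
  | zero => simp [atZero, series]
  | succ t =>
    simp [atZero, series, PowerSeries.coeff_succ_X_mul,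
      PowerSeries.coeff_mul_C]

variable {d}

/-- Summing the received contributions of all columns evaluates a localized state-feedback map. -/
theorem series_column_sum {G : ℕ → Matrix Q X ℝ}
    (hG : ∀ k a c, G k a c = (out c).mulVec (((F c).A ^ k).mulVec (F c).B) a)
    (hloc : S.Localized own S.nodeX d G)
    {n : ℕ → (c : X) → Fin (F c).dim → ℝ} {g : ℕ → X → ℝ}
    (hn : ∀ t c, n (t + 1) c = (F c).A.mulVec (n t c) + g (t + 1) c • (F c).B) :
    series (fun t a => ∑ c, received S.nodeX (S.inNbr d (own a))
        (fun c => (out c).mulVec (n t c) a) c) =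
      (transfer G).mulVec (series g) +
        columnResponse S d F own out (fun c => n 0 c - g 0 c • (F c).B) := by
  ext1 a
  have h1 : ∀ c, (gain (out c)).mulVec (series fun t => n t c) a =
      transfer G a c * series g c + (gain (out c)).mulVec ((resolventSeries (F c).A).mulVec
        (atZero (n 0 c - g 0 c • (F c).B))) a := by
    intro c
    rw [series_column_state hn, Matrix.mulVec_add, Matrix.mulVec_add, Pi.add_apply,
      Matrix.mulVec_smul, Matrix.mulVec_smul, Pi.smul_apply, smul_eq_mul, mul_comm]
    congr 2
    refine (dotProduct_resolvent_mulVec (F c).A (F c).B (out c a)).trans ?_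
    simp only [transfer, Matrix.of_apply, hG]
    rfl
  have h2 : series (fun t a => ∑ c, received S.nodeX (S.inNbr d (own a))
        (fun c => (out c).mulVec (n t c) a) c) a =
      ∑ c, Set.indicator (S.nodeX ⁻¹' S.inNbr d (own a))
        (fun c => (gain (out c)).mulVec (series fun t => n t c) a) c := by
    ext t
    simp only [series, PowerSeries.coeff_mk, map_sum]
    refine Finset.sum_congr rfl fun c _ => ?_
    simp only [← series_mulVec]
    by_cases hc : c ∈ S.nodeX ⁻¹' S.inNbr d (own a)
    · rw [received, Set.indicator_of_mem hc, Set.indicator_of_mem hc]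
      simp [series]
    · rw [received, Set.indicator_of_notMem hc, Set.indicator_of_notMem hc, map_zero]
  rw [h2, Pi.add_apply]
  simp only [h1]
  rw [Matrix.mulVec, dotProduct, columnResponse, ← Finset.sum_add_distrib]
  refine Finset.sum_congr rfl fun c _ => ?_
  by_cases hc : c ∈ S.nodeX ⁻¹' S.inNbr d (own a)
  · rw [Set.indicator_of_mem hc, Set.indicator_of_mem hc]
  · have h3 : transfer G a c = 0 := by
      ext k
      simpa [transfer] using hloc k a c hc
    rw [Set.indicator_of_notMem hc, Set.indicator_of_notMem hc, h3, zero_mul, zero_add]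

end Columns

/-! ### The equations of the closed loop -/

section Trajectory

variable {N X U Y : Type*} [Fintype X] [Fintype U] [Fintype Y]

/-- The signals of the closed loop in which only the plant is perturbed, by the noises `w` and `v`,
and whose controller starts in an arbitrary state. The signals that are static functions of other
ones satisfy their defining equations from the initial time on. -/
structure IsTrajectory (S : Network N X U Y) (K : ControllerData X U Y) (d : ℕ)
    (s : ℕ → Signals K) (w : ℕ → X → ℝ) (v : ℕ → Y → ℝ) : Prop where
  p_succ : ∀ t a, (s (t + 1)).p a = (K.ew a).A.mulVec ((s t).p a) +
    (K.ew a).B.mulVec (received S.nodeX (S.inNbr d (S.nodeX a)) (s t).beta)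
  q_succ : ∀ t a, (s (t + 1)).q a = (K.ev a).A.mulVec ((s t).q a) +
    (K.ev a).B.mulVec (received S.nodeY (S.inNbr d (S.nodeX a)) (S.C.mulVec (s t).x + v t))
  wHat : ∀ t, (s t).wHat = fun a => (K.ew a).C ⬝ᵥ (s t).p a
  vHat : ∀ t, (s t).vHat = fun a => (K.ev a).C ⬝ᵥ (s t).q a
  wTilde_succ : ∀ t, (s (t + 1)).wTilde =
    (s t).beta + S.A.mulVec (s t).wHat - (s (t + 1)).wHat
  vTilde_succ : ∀ t, (s (t + 1)).vTilde = S.A.mulVec (s t).vHat - (s (t + 1)).vHat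
  lam_succ : ∀ t c, (s (t + 1)).lam c =
    (K.sf c).A.mulVec ((s t).lam c) + (s (t + 1)).wTilde c • (K.sf c).B
  xi_succ : ∀ t c, (s (t + 1)).xi c =
    (K.sf c).A.mulVec ((s t).xi c) + (s (t + 1)).vTilde c • (K.sf c).B
  alpha : ∀ t, (s t).alpha = (s t).wHat + fun a => ∑ c, received S.nodeX
    (S.inNbr d (S.nodeX a)) (fun c => (K.sf c).C.mulVec ((s t).lam c) a) c
  gamma : ∀ t, (s t).gamma = fun a => ∑ c, received S.nodeX
    (S.inNbr d (S.nodeU a)) (fun c => (K.sf c).K.mulVec ((s t).lam c) a) c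
  zeta : ∀ t, (s t).zeta = (s t).vHat + fun a => ∑ c, received S.nodeX
    (S.inNbr d (S.nodeX a)) (fun c => (K.sf c).C.mulVec ((s t).xi c) a) c
  theta_succ : ∀ t, (s (t + 1)).theta = fun a => ∑ c, received S.nodeX
    (S.inNbr d (S.nodeU a)) (fun c => (K.sf c).K.mulVec ((s t).xi c) a) c
  beta : ∀ t, (s t).beta = -S.A.mulVec (s t).alpha - S.B.mulVec (s t).gamma - (s t).zeta
  u : ∀ t, (s t).u = (s t).gamma + (s t).theta
  x_succ : ∀ t, (s (t + 1)).x = S.A.mulVec (s t).x + S.B.mulVec (s (t + 1)).u + w t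

/-- A perturbation of the plant state and of the measurement only. -/
def plantNoise {K : ControllerData X U Y} (w : X → ℝ) (v : Y → ℝ) : Signals K :=
  { (Signals.zero : Signals K) with x := w, y := v }

/-- A run of the algorithm is a trajectory if its initial values are the zero values or the result
of an earlier pass. -/
theorem IsTrajectory.of_step {S : Network N X U Y} {K : ControllerData X U Y} {d : ℕ}
    {s : ℕ → Signals K} {w : ℕ → X → ℝ} {v : ℕ → Y → ℝ}
    (h0 : s 0 = Signals.zero ∨ ∃ s', s 0 = closedLoopStep S K d s' Signals.zero)
    (hs : ∀ t, s (t + 1) = closedLoopStep S K d (s t) (plantNoise (w t) (v t))) :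
    IsTrajectory S K d s w v := by
  have hcases : ∀ t, s t = Signals.zero ∨
      ∃ s' w v, s t = closedLoopStep S K d s' (plantNoise w v) := by
    intro t
    cases t with
    | zero => exact h0.imp id fun ⟨s', h⟩ => ⟨s', 0, 0, h⟩
    | succ t => exact Or.inr ⟨_, _, _, hs t⟩
  constructor
  · intro t a; rw [hs]; exact add_zero _
  · intro t a; rw [hs]; exact add_zero _
  · intro t
    obtain h | ⟨s', w', v', h⟩ := hcases t <;> rw [h]
    · simp [Signals.zero]; rfl
    · exact add_zero _
  · intro t
    obtain h | ⟨s', w', v', h⟩ := hcases t <;> rw [h]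
    · simp [Signals.zero]; rfl
    · exact add_zero _
  · intro t; rw [hs]
    refine (add_zero _).trans ?_
    simp only [S.A_dotProduct_received]; rfl
  · intro t; rw [hs]
    refine (add_zero _).trans ?_
    simp only [S.A_dotProduct_received]; rfl
  · intro t a; rw [hs]; exact add_zero _
  · intro t a; rw [hs]; exact add_zero _
  · intro t
    obtain h | ⟨s', w', v', h⟩ := hcases t <;> rw [h]
    · ext a; simp [Signals.zero, received]
    · set r := closedLoopStep S K d s' (plantNoise w' v')
      have hh : r.alphaHat = fun c => (K.sf c).C.mulVec (r.lam c) := add_zero _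
      have : r.alpha = r.wHat + fun a => ∑ c, received S.nodeX
        (S.inNbr d (S.nodeX a)) (fun c => r.alphaHat c a) c := add_zero _
      rw [this, hh]
  · intro t
    obtain h | ⟨s', w', v', h⟩ := hcases t <;> rw [h]
    · ext a; simp [Signals.zero, received]
    · set r := closedLoopStep S K d s' (plantNoise w' v')
      have hh : r.gammaHat = fun c => (K.sf c).K.mulVec (r.lam c) := add_zero _
      have : r.gamma = fun a => ∑ c, received S.nodeX
        (S.inNbr d (S.nodeU a)) (fun c => r.gammaHat c a) c := add_zero _
      rw [this, hh]
  · intro t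
    obtain h | ⟨s', w', v', h⟩ := hcases t <;> rw [h]
    · ext a; simp [Signals.zero, received]
    · set r := closedLoopStep S K d s' (plantNoise w' v')
      have hh : r.zetaHat = fun c => (K.sf c).C.mulVec (r.xi c) := add_zero _
      have : r.zeta = r.vHat + fun a => ∑ c, received S.nodeX
        (S.inNbr d (S.nodeX a)) (fun c => r.zetaHat c a) c := add_zero _
      rw [this, hh]
  · intro t
    rw [hs]
    set r := closedLoopStep S K d (s t) (plantNoise (w t) (v t))
    have hh : r.thetaHat = fun c => (K.sf c).K.mulVec ((s t).xi c) := add_zero _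
    have : r.theta = fun a => ∑ c, received S.nodeX
      (S.inNbr d (S.nodeU a)) (fun c => r.thetaHat c a) c := add_zero _
    rw [this, hh]
  · intro t
    obtain h | ⟨s', w', v', h⟩ := hcases t <;> rw [h]
    · simp [Signals.zero]
    · set r := closedLoopStep S K d s' (plantNoise w' v')
      have : r.beta = fun a => -(S.A a ⬝ᵥ received S.nodeX (S.inNbr 1 (S.nodeX a)) r.alpha) -
        S.B a ⬝ᵥ received S.nodeU (S.inNbr 1 (S.nodeX a)) r.gamma - r.zeta a := add_zero _
      simp only [this, S.A_dotProduct_received, S.B_dotProduct_received]; rfl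
  · intro t
    obtain h | ⟨s', w', v', h⟩ := hcases t <;> rw [h]
    · simp [Signals.zero]
    · exact add_zero _
  · intro t; rw [hs]; rfl

/-! ### The loop equations in the frequency domain -/

namespace IsTrajectory

variable {S : Network N X U Y} {K : ControllerData X U Y} {d : ℕ}
  {s : ℕ → Signals K} {w : ℕ → X → ℝ} {v : ℕ → Y → ℝ}

theorem series_wHat (h : IsTrajectory S K d s w v) (hd : K.MapsLocalized S d) :
    series (fun t => (s t).wHat) =
      𝕫 • (transfer fun k => K.kfW (k + 1)).mulVec (series fun t => (s t).beta) +
        rowResponse K.ew (s 0).p :=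
  series_row_output S S.nodeX K.ew (fun _ _ _ => rfl) (fun k => hd.2.2.1 (k + 1))
    (n := fun t => (s t).p) h.p_succ h.wHat

theorem series_vHat (h : IsTrajectory S K d s w v) (hd : K.MapsLocalized S d) :
    series (fun t => (s t).vHat) =
      (transfer K.kfV).mulVec ((gain S.C).mulVec (series fun t => (s t).x)) +
        ((transfer K.kfV).mulVec (series v) + rowResponse K.ev (s 0).q) := by
  have h1 := series_row_output S S.nodeY K.ev (G := fun k => K.kfV (k + 1)) (fun _ _ _ => rfl)
    (fun k => hd.2.2.2 (k + 1)) (n := fun t => (s t).q) h.q_succ h.vHat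
  rw [h1, series_add, series_mulVec, transfer_eq_X_smul (G := K.kfV) rfl]
  simp only [Matrix.smul_mulVec, Matrix.mulVec_add, smul_add, add_assoc]

theorem series_wTilde (h : IsTrajectory S K d s w v) :
    series (fun t => (s t).wTilde) = 𝕫 • series (fun t => (s t).beta) +
      𝕫 • (gain S.A).mulVec (series fun t => (s t).wHat) - series (fun t => (s t).wHat) +
        atZero ((s 0).wTilde + (s 0).wHat) := by
  have h1 := series_of_succ (f := fun t => (s t).wTilde + (s t).wHat)
    (g := fun t => (s t).beta + S.A.mulVec (s t).wHat) fun t => by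
      rw [h.wTilde_succ, sub_add_cancel]
  rw [series_add, series_add, series_mulVec] at h1
  rw [← smul_add, sub_add_eq_add_sub, ← h1, add_sub_cancel_right]

theorem series_vTilde (h : IsTrajectory S K d s w v) :
    series (fun t => (s t).vTilde) =
      𝕫 • (gain S.A).mulVec (series fun t => (s t).vHat) - series (fun t => (s t).vHat) +
        atZero ((s 0).vTilde + (s 0).vHat) := by
  have h1 := series_of_succ (f := fun t => (s t).vTilde + (s t).vHat)
    (g := fun t => S.A.mulVec (s t).vHat) fun t => by
      rw [h.vTilde_succ, sub_add_cancel]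
  rw [series_add, series_mulVec] at h1
  rw [sub_add_eq_add_sub, ← h1, add_sub_cancel_right]

theorem series_alpha (h : IsTrajectory S K d s w v) (hd : K.MapsLocalized S d) :
    series (fun t => (s t).alpha) = series (fun t => (s t).wHat) +
      (transfer fun k => K.sfX (k + 1)).mulVec (series fun t => (s t).wTilde) +
        columnResponse S d K.sf S.nodeX (fun c => (K.sf c).C)
          (fun c => (s 0).lam c - (s 0).wTilde c • (K.sf c).B) := by
  simp only [h.alpha]
  rw [series_add, series_column_sum S S.nodeX (fun c => (K.sf c).C)
    (G := fun k => K.sfX (k + 1)) (fun _ _ _ => rfl) (fun k => hd.1 (k + 1))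
    (g := fun t => (s t).wTilde) h.lam_succ, add_assoc]

theorem series_gamma (h : IsTrajectory S K d s w v) (hd : K.MapsLocalized S d) :
    series (fun t => (s t).gamma) =
      (transfer fun k => K.sfU (k + 1)).mulVec (series fun t => (s t).wTilde) +
        columnResponse S d K.sf S.nodeU (fun c => (K.sf c).K)
          (fun c => (s 0).lam c - (s 0).wTilde c • (K.sf c).B) := by
  simp only [h.gamma]
  exact series_column_sum S S.nodeU (fun c => (K.sf c).K) (fun _ _ _ => rfl)
    (fun k => hd.2.1 (k + 1)) h.lam_succ

theorem series_zeta (h : IsTrajectory S K d s w v) (hd : K.MapsLocalized S d) :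
    series (fun t => (s t).zeta) = series (fun t => (s t).vHat) +
      (transfer fun k => K.sfX (k + 1)).mulVec (series fun t => (s t).vTilde) +
        columnResponse S d K.sf S.nodeX (fun c => (K.sf c).C)
          (fun c => (s 0).xi c - (s 0).vTilde c • (K.sf c).B) := by
  simp only [h.zeta]
  rw [series_add, series_column_sum S S.nodeX (fun c => (K.sf c).C)
    (G := fun k => K.sfX (k + 1)) (fun _ _ _ => rfl) (fun k => hd.1 (k + 1))
    (g := fun t => (s t).vTilde) h.xi_succ, add_assoc]

theorem series_theta (h : IsTrajectory S K d s w v) (hd : K.MapsLocalized S d) :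
    series (fun t => (s t).theta) =
      𝕫 • (transfer fun k => K.sfU (k + 1)).mulVec (series fun t => (s t).vTilde) +
        (𝕫 • columnResponse S d K.sf S.nodeU (fun c => (K.sf c).K)
          (fun c => (s 0).xi c - (s 0).vTilde c • (K.sf c).B) + atZero (s 0).theta) := by
  rw [series_of_succ h.theta_succ, series_column_sum S S.nodeU (fun c => (K.sf c).K)
    (G := fun k => K.sfU (k + 1)) (fun _ _ _ => rfl) (fun k => hd.2.1 (k + 1))
    (g := fun t => (s t).vTilde) h.xi_succ, smul_add, add_assoc]

theorem series_beta (h : IsTrajectory S K d s w v) :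
    series (fun t => (s t).beta) = -(gain S.A).mulVec (series fun t => (s t).alpha) -
      (gain S.B).mulVec (series fun t => (s t).gamma) - series (fun t => (s t).zeta) := by
  rw [← series_mulVec, ← series_mulVec, ← series_neg, ← series_sub, ← series_sub]
  simp only [← h.beta]

theorem series_u (h : IsTrajectory S K d s w v) :
    series (fun t => (s t).u) =
      series (fun t => (s t).gamma) + series (fun t => (s t).theta) := by
  rw [← series_add]
  simp only [h.u]

theorem series_x (h : IsTrajectory S K d s w v) :
    series (fun t => (s t).x) = 𝕫 • (gain S.A).mulVec (series fun t => (s t).x) +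
      (gain S.B).mulVec (series fun t => (s t).u) + (𝕫 • series w +
        atZero ((s 0).x - S.B.mulVec (s 0).u)) := by
  have h1 := series_of_succ (f := fun t => (s t).x - S.B.mulVec (s t).u)
    (g := fun t => S.A.mulVec (s t).x + w t) fun t => by
      rw [h.x_succ]; abel
  rw [series_add, series_sub, series_mulVec, series_mulVec, sub_eq_iff_eq_add, smul_add] at h1
  refine h1.trans ?_
  abel

end IsTrajectory

omit [Fintype Y] in
/-- The state-feedback constraint as an identity of transfer matrices. -/
theorem ControllerData.SFFeasible.mulVec_eq [DecidableEq X] {S : Network N X U Y}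
    {K : ControllerData X U Y} (h : K.SFFeasible S) (m : X → PowerSeries ℝ) :
    (transfer fun k => K.sfX (k + 1)).mulVec m = m +
      𝕫 • (gain S.A).mulVec
        ((transfer fun k => K.sfX (k + 1)).mulVec m) +
      𝕫 • (gain S.B).mulVec
        ((transfer fun k => K.sfU (k + 1)).mulVec m) := by
  have h1 : (transfer fun k => K.sfX (k + 1)) = 1 + gain S.A * transfer K.sfX +
      gain S.B * transfer K.sfU := by
    ext a b k
    have h2 := h k
    rw [sub_sub, sub_eq_iff_eq_add] at h2
    simp only [transfer, Matrix.add_apply, Matrix.of_apply, PowerSeries.coeff_mk, h2, map_add,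
      Matrix.mul_apply, map_sum, Matrix.map_apply, PowerSeries.coeff_C_mul, Matrix.one_apply]
    by_cases hk : k = 0 <;> by_cases hab : a = b <;>
      simp [hk, hab, PowerSeries.coeff_one, add_assoc, Matrix.one_apply]
  conv_lhs => rw [h1, transfer_eq_X_smul (G := K.sfX) rfl,
    transfer_eq_X_smul (G := K.sfU) rfl]
  simp only [Matrix.add_mulVec, Matrix.one_mulVec, Matrix.mulVec_mulVec, Matrix.mul_smul,
    Matrix.smul_mulVec]

omit [Fintype U] in
/-- The Kalman-filter constraint as an identity of transfer matrices. -/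
theorem ControllerData.KFFeasible.mulVec_eq [DecidableEq X] {S : Network N X U Y}
    {K : ControllerData X U Y} (h : K.KFFeasible S) (m : X → PowerSeries ℝ) :
    (transfer fun k => K.kfW (k + 1)).mulVec m = m +
      𝕫 • (transfer fun k => K.kfW (k + 1)).mulVec
        ((gain S.A).mulVec m) +
      (transfer K.kfV).mulVec ((gain S.C).mulVec m) := by
  have h1 : (transfer fun k => K.kfW (k + 1)) = 1 + transfer K.kfW * gain S.A +
      transfer K.kfV * gain S.C := by
    ext a b k
    have h2 := h k
    rw [sub_sub, sub_eq_iff_eq_add] at h2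
    simp only [transfer, Matrix.add_apply, Matrix.of_apply, PowerSeries.coeff_mk, h2, map_add,
      Matrix.mul_apply, map_sum, Matrix.map_apply, PowerSeries.coeff_mul_C, Matrix.one_apply]
    by_cases hk : k = 0 <;> by_cases hab : a = b <;>
      simp [hk, hab, PowerSeries.coeff_one, add_assoc, Matrix.one_apply]
  conv_lhs => rw [h1, transfer_eq_X_smul (G := K.kfW) rfl]
  simp only [Matrix.add_mulVec, Matrix.one_mulVec, Matrix.mulVec_mulVec, Matrix.smul_mul,
    Matrix.smul_mulVec]

end Trajectory

section

variable {N X U Y : Type*} [Fintype X] [Fintype U] [Fintype Y]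

namespace IsTrajectory

variable {S : Network N X U Y} {K : ControllerData X U Y} {d : ℕ}
  {s : ℕ → Signals K} {w : ℕ → X → ℝ} {v : ℕ → Y → ℝ}

/-! ### The response to the noises -/

/-- Started at zero, the closed loop realizes the output-feedback maps
`Φxw = Φx + Φew + Φx (A - z I) Φew`, `Φxv = Φev + Φx (A - z I) Φev`,
`Φuw = Φu + Φu (A - z I) Φew` and `Φuv = Φu (A - z I) Φev`, where `Φx` and `Φu` are the
state-feedback maps. Here `g` collects the Kalman-filter responses, and the series of `u` carries
an additional delay. -/
theorem plant_response [DecidableEq X] (h : IsTrajectory S K d s w v) (h0 : s 0 = Signals.zero)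
    (hSF : K.SFFeasible S) (hKF : K.KFFeasible S) (hd : K.MapsLocalized S d)
    {g r : X → PowerSeries ℝ}
    (hg : g = (transfer K.kfW).mulVec (series w) + (transfer K.kfV).mulVec (series v))
    (hr : r = 𝕫 • series w + 𝕫 • (gain S.A).mulVec g - g) :
    series (fun t => (s t).x) = (transfer fun k => K.sfX (k + 1)).mulVec r + g ∧
      series (fun t => (s t).u) = 𝕫 • (transfer fun k => K.sfU (k + 1)).mulVec r := by
  have hn : ∀ n : (c : X) → Fin (K.sf c).dim → ℝ, ∀ g : X → ℝ, n = 0 → g = 0 →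
      (fun c => n c - g c • (K.sf c).B) = 0 := by
    rintro _ _ rfl rfl; ext; simp
  have h1 := h.series_wHat hd
  have h2 := h.series_vHat hd
  have h3 := h.series_wTilde
  have h4 := h.series_vTilde
  have h5 := h.series_alpha hd
  have h6 := h.series_gamma hd
  have h7 := h.series_zeta hd
  have h8 := h.series_theta hd
  have h11 := h.series_x
  rw [hn _ _ (by rw [h0]; rfl) (by rw [h0]; rfl), columnResponse_zero] at h5 h6 h7 h8
  rw [show (s 0).p = 0 by rw [h0]; rfl, rowResponse_zero] at h1
  rw [show (s 0).q = 0 by rw [h0]; rfl, rowResponse_zero, add_zero] at h2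
  rw [show (s 0).wTilde + (s 0).wHat = 0 by rw [h0]; exact add_zero _, atZero_zero] at h3
  rw [show (s 0).vTilde + (s 0).vHat = 0 by rw [h0]; exact add_zero _, atZero_zero] at h4
  rw [show (s 0).theta = 0 by rw [h0]; rfl, atZero_zero, smul_zero, add_zero] at h8
  rw [show (s 0).x - S.B.mulVec (s 0).u = 0 by rw [h0]; simp [Signals.zero], atZero_zero,
    add_zero] at h11
  obtain ⟨-, hu, hx, -⟩ := loop_elimination (z := 𝕫) (A := (gain S.A).mulVecLin)
    (B := (gain S.B).mulVecLin) (Ψx := (transfer fun k => K.sfX (k + 1)).mulVecLin)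
    (Ψu := (transfer fun k => K.sfU (k + 1)).mulVecLin)
    (W := (transfer fun k => K.kfW (k + 1)).mulVecLin)
    (VC := (transfer K.kfV).mulVecLin ∘ₗ (gain S.C).mulVecLin)
    hSF.mulVec_eq hKF.mulVec_eq h1 h2 h3 h4 h5 h6 h7 h8 h.series_beta
    h.series_u h11 rfl rfl rfl rfl rfl
  rw [transfer_eq_X_smul (G := K.kfW) rfl, Matrix.smul_mulVec] at hg
  rw [← smul_add] at hr
  simp only [map_zero, smul_zero, add_zero, sub_zero, map_smul, ← smul_add, ← smul_sub,
    Matrix.mulVecLin_apply, ← hg, ← hr] at hu hx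
  exact ⟨X_smul_cancel hx, hu⟩

/-! ### Stability of the unperturbed loop -/

omit [Fintype X] [Fintype U] [Fintype Y] in
theorem summableVec_transfer_row {Q : Type*} {F : X → KFRow Q}
    (hF : ∀ a, IsSchurStable (F a).A) {G : ℕ → Matrix X Q ℝ}
    (hG : ∀ k a c, G k a c = Matrix.vecMul (F a).C ((F a).A ^ k * (F a).B) c) (a : X) :
    SummableVec (transfer G a) := by
  intro c
  have h := dotProduct_resolvent_mulVec (F a).A (fun i => (F a).B i c) (F a).C
  have h1 : transfer G a c = _ :=
    Eq.trans (by simp only [transfer, Matrix.of_apply, hG]; rfl) h.symm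
  rw [h1]
  exact (SummableVec.of_atZero _).dotProduct
    (SummableVec.resolvent_mulVec (hF a) (SummableVec.of_atZero _))

omit [Fintype X] [Fintype U] [Fintype Y] in
theorem summableVec_transfer_column {Q : Type*} {F : X → SFColumn X U}
    (hF : ∀ c, IsSchurStable (F c).A) (out : (c : X) → Matrix Q (Fin (F c).dim) ℝ)
    {G : ℕ → Matrix Q X ℝ}
    (hG : ∀ k a c, G k a c = (out c).mulVec (((F c).A ^ k).mulVec (F c).B) a) (a : Q) :
    SummableVec (transfer G a) := by
  intro c
  have h := dotProduct_resolvent_mulVec (F c).A (F c).B (out c a)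
  have h1 : transfer G a c = _ :=
    Eq.trans (by simp only [transfer, Matrix.of_apply, hG]; rfl) h.symm
  rw [h1]
  exact (SummableVec.of_atZero _).dotProduct
    (SummableVec.resolvent_mulVec (hF c) (SummableVec.of_atZero _))

/-- Without noise the plant state and the signals that drive the realizations are absolutely
summable, whatever the initial values are. -/
theorem summable [DecidableEq X] (h : IsTrajectory S K d s (fun _ => 0) (fun _ => 0))
    (hstable : K.Stable) (hSF : K.SFFeasible S) (hKF : K.KFFeasible S)
    (hd : K.MapsLocalized S d) :
    SummableVec (series fun t => (s t).x) ∧ SummableVec (series fun t => (s t).beta) ∧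
      SummableVec (series fun t => (s t).wHat) ∧ SummableVec (series fun t => (s t).vHat) ∧
      SummableVec (series fun t => (s t).wTilde) ∧ SummableVec (series fun t => (s t).vTilde) := by
  have hΨx := summableVec_transfer_column hstable.1 (fun c => (K.sf c).C)
    (G := fun k => K.sfX (k + 1)) (fun _ _ _ => rfl)
  have hΨu := summableVec_transfer_column hstable.1 (fun c => (K.sf c).K)
    (G := fun k => K.sfU (k + 1)) (fun _ _ _ => rfl)
  have hW := summableVec_transfer_row hstable.2.1
    (G := fun k => K.kfW (k + 1)) (fun _ _ _ => rfl)
  have hV : ∀ a, SummableVec (transfer K.kfV a) := by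
    have := summableVec_transfer_row hstable.2.2
      (G := fun k => K.kfV (k + 1)) (fun _ _ _ => rfl)
    intro a
    rw [transfer_eq_X_smul (G := K.kfV) rfl]
    exact (this a).X_smul
  have e1 : SummableVec (rowResponse K.ew (s 0).p) := SummableVec.rowResponse hstable.2.1 _
  have h2 := h.series_vHat hd
  rw [series_zero, Matrix.mulVec_zero,
    zero_add] at h2
  have e2 : SummableVec (rowResponse K.ev (s 0).q) := SummableVec.rowResponse hstable.2.2 _
  have h11 := h.series_x
  rw [series_zero, smul_zero, zero_add] at h11
  have e5 := SummableVec.columnResponse S d K.sf S.nodeX (fun c => (K.sf c).C) hstable.1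
    (fun c => (s 0).lam c - (s 0).wTilde c • (K.sf c).B)
  have e6 := SummableVec.columnResponse S d K.sf S.nodeU (fun c => (K.sf c).K) hstable.1
    (fun c => (s 0).lam c - (s 0).wTilde c • (K.sf c).B)
  have e7 := SummableVec.columnResponse S d K.sf S.nodeX (fun c => (K.sf c).C) hstable.1
    (fun c => (s 0).xi c - (s 0).vTilde c • (K.sf c).B)
  have e8 := SummableVec.columnResponse S d K.sf S.nodeU (fun c => (K.sf c).K) hstable.1
    (fun c => (s 0).xi c - (s 0).vTilde c • (K.sf c).B)
  have e3 : SummableVec (atZero ((s 0).wTilde + (s 0).wHat)) := SummableVec.of_atZero _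
  have e4 : SummableVec (atZero ((s 0).vTilde + (s 0).vHat)) := SummableVec.of_atZero _
  have e8' : SummableVec (atZero (s 0).theta) := SummableVec.of_atZero _
  have e11 : SummableVec (atZero ((s 0).x - S.B.mulVec (s 0).u)) := SummableVec.of_atZero _
  have e68 := e6.add (e8.X_smul.add e8')
  have hee := e3.sub ((e7.add (e5.gain_mulVec S.A)).add (e6.gain_mulVec S.B)).X_smul
  have her := e3.add e4.X_smul
  have heb := (((e68.gain_mulVec S.B).X_smul.add hee).sub (hee.gain_mulVec S.A).X_smul).sub her
  have hex := (((e11.mulVec hW).X_smul.add (heb.mulVec hW)).add e1).add e2.X_smul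
  have hr := (((e11.X_smul.add heb).add (hex.gain_mulVec S.A).X_smul).sub hex).add her
  obtain ⟨-, hu, hx, hb⟩ := loop_elimination (z := 𝕫) (A := (gain S.A).mulVecLin)
    (B := (gain S.B).mulVecLin) (Ψx := (transfer fun k => K.sfX (k + 1)).mulVecLin)
    (Ψu := (transfer fun k => K.sfU (k + 1)).mulVecLin)
    (W := (transfer fun k => K.kfW (k + 1)).mulVecLin)
    (VC := (transfer K.kfV).mulVecLin ∘ₗ (gain S.C).mulVecLin)
    hSF.mulVec_eq hKF.mulVec_eq (h.series_wHat hd) h2 h.series_wTilde h.series_vTilde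
    (h.series_alpha hd) (h.series_gamma hd) (h.series_zeta hd) (h.series_theta hd) h.series_beta
    h.series_u h11 rfl rfl rfl rfl rfl
  have su : SummableVec (series fun t => (s t).u) := by
    rw [hu]; exact (hr.mulVec hΨu).add e68
  have sx : SummableVec (series fun t => (s t).x) := by
    rw [← SummableVec.X_smul_iff, hx]; exact ((hr.mulVec hΨx).sub hee).add hex
  have sb : SummableVec (series fun t => (s t).beta) := by
    rw [← SummableVec.X_smul_iff, hb]; exact (su.gain_mulVec S.B).X_smul.neg.add heb
  have sw : SummableVec (series fun t => (s t).wHat) := by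
    rw [h.series_wHat hd]; exact (sb.mulVec hW).X_smul.add e1
  have sv : SummableVec (series fun t => (s t).vHat) := by
    rw [h2]; exact ((sx.gain_mulVec S.C).mulVec hV).add e2
  refine ⟨sx, sb, sw, sv, ?_, ?_⟩
  · rw [h.series_wTilde]
    exact ((sb.X_smul.add (sw.gain_mulVec S.A).X_smul).sub sw).add e3
  · rw [h.series_vTilde]
    exact ((sv.gain_mulVec S.A).X_smul.sub sv).add e4

omit [Fintype X] [Fintype U] [Fintype Y] in
theorem summableVec_received {Q : Type*} {f : ℕ → Q → ℝ} (hf : SummableVec (series f))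
    (own : Q → N) (i : Set N) : SummableVec (series fun t => received own i (f t)) := by
  intro c
  by_cases hc : c ∈ own ⁻¹' i
  · have : series (fun t => received own i (f t)) c = series f c := by
      ext t
      simp only [series, received, PowerSeries.coeff_mk, Set.indicator_of_mem hc]
    rw [this]
    exact hf c
  · have : series (fun t => received own i (f t)) c = 0 := by
      ext t
      simp [series, received, Set.indicator_of_notMem hc]
    rw [this]
    exact SummableSeries.zero

/-- Without noise the states of the plant and of the realizations converge to zero. -/
theorem tendsto_zero [DecidableEq X] (h : IsTrajectory S K d s (fun _ => 0) (fun _ => 0))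
    (hstable : K.Stable) (hSF : K.SFFeasible S) (hKF : K.KFFeasible S)
    (hd : K.MapsLocalized S d) :
    Filter.Tendsto (fun t => (s t).p) Filter.atTop (nhds 0) ∧
      Filter.Tendsto (fun t => (s t).q) Filter.atTop (nhds 0) ∧
      Filter.Tendsto (fun t => (s t).wHat) Filter.atTop (nhds 0) ∧
      Filter.Tendsto (fun t => (s t).vHat) Filter.atTop (nhds 0) ∧
      Filter.Tendsto (fun t => (s t).lam) Filter.atTop (nhds 0) ∧
      Filter.Tendsto (fun t => (s t).xi) Filter.atTop (nhds 0) ∧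
      Filter.Tendsto (fun t => (s t).beta) Filter.atTop (nhds 0) ∧
      Filter.Tendsto (fun t => (s t).x) Filter.atTop (nhds 0) := by
  obtain ⟨sx, sb, sw, sv, swt, svt⟩ := h.summable hstable hSF hKF hd
  have hmul : ∀ {m : ℕ} {f : PowerSeries ℝ} (B : Fin m → ℝ), SummableSeries f →
      SummableVec (f • atZero B) := fun B hf i => hf.mul (SummableSeries.of_C _)
  refine ⟨tendsto_pi_nhds.2 fun a => ?_, tendsto_pi_nhds.2 fun a => ?_, sw.tendsto_zero,
    sv.tendsto_zero, tendsto_pi_nhds.2 fun c => ?_, tendsto_pi_nhds.2 fun c => ?_,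
    sb.tendsto_zero, sx.tendsto_zero⟩
  · apply SummableVec.tendsto_zero
    rw [series_of_recursion (K.ew a).A (fun t => h.p_succ t a), series_mulVec]
    exact SummableVec.resolvent_mulVec (hstable.2.1 a)
      (((summableVec_received sb _ _).gain_mulVec _).X_smul.add (SummableVec.of_atZero _))
  · apply SummableVec.tendsto_zero
    have sy : SummableVec (series fun t => S.C.mulVec (s t).x + 0) := by
      simp only [add_zero]
      rw [series_mulVec]
      exact sx.gain_mulVec _
    rw [series_of_recursion (K.ev a).A (fun t => h.q_succ t a), series_mulVec]
    exact SummableVec.resolvent_mulVec (hstable.2.2 a)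
      (((summableVec_received sy _ _).gain_mulVec _).X_smul.add (SummableVec.of_atZero _))
  · apply SummableVec.tendsto_zero
    rw [series_column_state (n := fun t => (s t).lam) (g := fun t => (s t).wTilde) h.lam_succ]
    exact SummableVec.resolvent_mulVec (hstable.1 c)
      ((hmul _ (swt c)).add (SummableVec.of_atZero _))
  · apply SummableVec.tendsto_zero
    rw [series_column_state (n := fun t => (s t).xi) (g := fun t => (s t).vTilde) h.xi_succ]
    exact SummableVec.resolvent_mulVec (hstable.1 c)
      ((hmul _ (svt c)).add (SummableVec.of_atZero _))

end IsTrajectory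

end

/-! ### The normed space of all signals -/

section SignalSpace

variable {X U Y : Type*} {K : ControllerData X U Y}

namespace Signals

/-- The signals as a product of coordinate spaces. -/
def equivProd (K : ControllerData X U Y) : Signals K ≃
    (Y → ℝ) × ((a : X) → Fin (K.ew a).dim → ℝ) × ((a : X) → Fin (K.ev a).dim → ℝ) ×
    (X → ℝ) × (X → ℝ) × (X → ℝ) × (X → ℝ) × ((c : X) → Fin (K.sf c).dim → ℝ) ×
    ((c : X) → Fin (K.sf c).dim → ℝ) × (X → X → ℝ) × (X → X → ℝ) × (X → U → ℝ) × (X → U → ℝ) ×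
    (X → ℝ) × (U → ℝ) × (X → ℝ) × (U → ℝ) × (X → ℝ) × (U → ℝ) × (X → ℝ) where
  toFun s := (s.y, s.p, s.q, s.wHat, s.vHat, s.wTilde, s.vTilde, s.lam, s.xi, s.alphaHat,
    s.zetaHat, s.gammaHat, s.thetaHat, s.alpha, s.gamma, s.zeta, s.theta, s.beta, s.u, s.x)
  invFun := fun (y, p, q, wHat, vHat, wTilde, vTilde, lam, xi, alphaHat, zetaHat, gammaHat,
      thetaHat, alpha, gamma, zeta, theta, beta, u, x) =>
    { y, p, q, wHat, vHat, wTilde, vTilde, lam, xi, alphaHat, zetaHat, gammaHat, thetaHat,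
      alpha, gamma, zeta, theta, beta, u, x }
  left_inv _ := rfl
  right_inv _ := rfl

noncomputable instance : AddCommGroup (Signals K) := (equivProd K).addCommGroup

noncomputable instance : Module ℝ (Signals K) := (equivProd K).module ℝ

-- the product has twenty factors
set_option synthInstance.maxHeartbeats 200000 in
instance [Fintype X] [Fintype U] [Fintype Y] : FiniteDimensional ℝ (Signals K) :=
  Module.Finite.equiv ((equivProd K).linearEquiv ℝ).symm

theorem zero_eq : (0 : Signals K) = Signals.zero := rfl

theorem add_eq (s r : Signals K) : s + r =
    { y := s.y + r.y, p := s.p + r.p, q := s.q + r.q, wHat := s.wHat + r.wHat,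
      vHat := s.vHat + r.vHat, wTilde := s.wTilde + r.wTilde, vTilde := s.vTilde + r.vTilde,
      lam := s.lam + r.lam, xi := s.xi + r.xi, alphaHat := s.alphaHat + r.alphaHat,
      zetaHat := s.zetaHat + r.zetaHat, gammaHat := s.gammaHat + r.gammaHat,
      thetaHat := s.thetaHat + r.thetaHat, alpha := s.alpha + r.alpha,
      gamma := s.gamma + r.gamma, zeta := s.zeta + r.zeta, theta := s.theta + r.theta,
      beta := s.beta + r.beta, u := s.u + r.u, x := s.x + r.x } := rfl

theorem smul_eq (k : ℝ) (s : Signals K) : k • s =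
    { y := k • s.y, p := k • s.p, q := k • s.q, wHat := k • s.wHat,
      vHat := k • s.vHat, wTilde := k • s.wTilde, vTilde := k • s.vTilde,
      lam := k • s.lam, xi := k • s.xi, alphaHat := k • s.alphaHat,
      zetaHat := k • s.zetaHat, gammaHat := k • s.gammaHat,
      thetaHat := k • s.thetaHat, alpha := k • s.alpha,
      gamma := k • s.gamma, zeta := k • s.zeta, theta := k • s.theta,
      beta := k • s.beta, u := k • s.u, x := k • s.x } := rfl

variable [Fintype X] [Fintype U] [Fintype Y]

/-- The size of the signals is a norm. -/
noncomputable instance : NormedAddCommGroup (Signals K) :=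
  AddGroupNorm.toNormedAddCommGroup
    { toFun := size
      map_zero' := by simp [zero_eq, Signals.zero, size]
      add_le' := fun s r => by
        simp only [add_eq, size]
        linarith [norm_add_le s.y r.y, norm_add_le s.p r.p, norm_add_le s.q r.q,
          norm_add_le s.wHat r.wHat, norm_add_le s.vHat r.vHat, norm_add_le s.wTilde r.wTilde,
          norm_add_le s.vTilde r.vTilde, norm_add_le s.lam r.lam, norm_add_le s.xi r.xi,
          norm_add_le s.alphaHat r.alphaHat, norm_add_le s.zetaHat r.zetaHat,
          norm_add_le s.gammaHat r.gammaHat, norm_add_le s.thetaHat r.thetaHat,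
          norm_add_le s.alpha r.alpha, norm_add_le s.gamma r.gamma, norm_add_le s.zeta r.zeta,
          norm_add_le s.theta r.theta, norm_add_le s.beta r.beta, norm_add_le s.u r.u,
          norm_add_le s.x r.x]
      neg' := fun s => by
        rw [← neg_one_smul ℝ s]
        simp only [smul_eq, size, norm_smul, norm_neg, norm_one, one_mul]
      eq_zero_of_map_eq_zero' := fun s hs => by
        obtain ⟨y, p, q, wHat, vHat, wTilde, vTilde, lam, xi, alphaHat, zetaHat, gammaHat,
          thetaHat, alpha, gamma, zeta, theta, beta, u, x⟩ := s
        simp only [size] at hs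
        rw [zero_eq, Signals.zero]
        congr 1 <;> rw [← norm_le_zero_iff] <;>
          refine le_trans ?_ hs.le <;> linarith [norm_nonneg y, norm_nonneg p, norm_nonneg q,
          norm_nonneg wHat, norm_nonneg vHat, norm_nonneg wTilde, norm_nonneg vTilde,
          norm_nonneg lam, norm_nonneg xi, norm_nonneg alphaHat, norm_nonneg zetaHat,
          norm_nonneg gammaHat, norm_nonneg thetaHat, norm_nonneg alpha, norm_nonneg gamma,
          norm_nonneg zeta, norm_nonneg theta, norm_nonneg beta, norm_nonneg u, norm_nonneg x] }

theorem norm_eq_size (s : Signals K) : ‖s‖ = s.size := rfl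

noncomputable instance : NormedSpace ℝ (Signals K) where
  norm_smul_le k s := by
    simp only [norm_eq_size, smul_eq, size, norm_smul]
    exact le_of_eq (by ring)

end Signals

end SignalSpace

section Linear

variable {N X U Y : Type*} [Fintype X] [Fintype U] [Fintype Y]

/-! ### Linearity of the closed loop -/

theorem received_add {N Q : Type*} (own : Q → N) (i : Set N) (f g : Q → ℝ) :
    received own i (f + g) = received own i f + received own i g :=
  Set.indicator_add' _ _ _

theorem received_smul {N Q : Type*} (own : Q → N) (i : Set N) (k : ℝ) (f : Q → ℝ) :
    received own i (k • f) = k • received own i f :=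
  Set.indicator_const_smul (own ⁻¹' i) k f

theorem received_add_apply {N Q : Type*} (own : Q → N) (i : Set N) (f g : Q → ℝ) (c : Q) :
    received own i (fun c => f c + g c) c = received own i f c + received own i g c :=
  congrFun (received_add own i f g) c

theorem received_mul_apply {N Q : Type*} (own : Q → N) (i : Set N) (k : ℝ) (f : Q → ℝ) (c : Q) :
    received own i (fun c => k * f c) c = k * received own i f c :=
  congrFun (received_smul own i k f) c

/-- The equations of one pass, each signal being expressed by the final values of the others. In
this form they are visibly linear. -/
structure IsStep (S : Network N X U Y) (K : ControllerData X U Y) (d : ℕ)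
    (s δ r : Signals K) : Prop where
  y : r.y = S.C.mulVec s.x + δ.y
  p : r.p = (fun a => (K.ew a).A.mulVec (s.p a) +
    (K.ew a).B.mulVec (received S.nodeX (S.inNbr d (S.nodeX a)) s.beta)) + δ.p
  q : r.q = (fun a => (K.ev a).A.mulVec (s.q a) +
    (K.ev a).B.mulVec (received S.nodeY (S.inNbr d (S.nodeX a)) r.y)) + δ.q
  wHat : r.wHat = (fun a => (K.ew a).C ⬝ᵥ r.p a) + δ.wHat
  vHat : r.vHat = (fun a => (K.ev a).C ⬝ᵥ r.q a) + δ.vHat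
  wTilde : r.wTilde = (fun a => s.beta a + S.A a ⬝ᵥ received S.nodeX
    (S.inNbr 1 (S.nodeX a)) s.wHat - r.wHat a) + δ.wTilde
  vTilde : r.vTilde = (fun a => S.A a ⬝ᵥ received S.nodeX
    (S.inNbr 1 (S.nodeX a)) s.vHat - r.vHat a) + δ.vTilde
  lam : r.lam = (fun c => (K.sf c).A.mulVec (s.lam c) + r.wTilde c • (K.sf c).B) + δ.lam
  xi : r.xi = (fun c => (K.sf c).A.mulVec (s.xi c) + r.vTilde c • (K.sf c).B) + δ.xi
  alphaHat : r.alphaHat = (fun c => (K.sf c).C.mulVec (r.lam c)) + δ.alphaHat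
  zetaHat : r.zetaHat = (fun c => (K.sf c).C.mulVec (r.xi c)) + δ.zetaHat
  gammaHat : r.gammaHat = (fun c => (K.sf c).K.mulVec (r.lam c)) + δ.gammaHat
  thetaHat : r.thetaHat = (fun c => (K.sf c).K.mulVec (s.xi c)) + δ.thetaHat
  alpha : r.alpha = (fun a => r.wHat a + ∑ c, received S.nodeX (S.inNbr d (S.nodeX a))
    (fun c => r.alphaHat c a) c) + δ.alpha
  gamma : r.gamma = (fun a => ∑ c, received S.nodeX (S.inNbr d (S.nodeU a))
    (fun c => r.gammaHat c a) c) + δ.gamma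
  zeta : r.zeta = (fun a => r.vHat a + ∑ c, received S.nodeX (S.inNbr d (S.nodeX a))
    (fun c => r.zetaHat c a) c) + δ.zeta
  theta : r.theta = (fun a => ∑ c, received S.nodeX (S.inNbr d (S.nodeU a))
    (fun c => r.thetaHat c a) c) + δ.theta
  beta : r.beta = (fun a => -(S.A a ⬝ᵥ received S.nodeX (S.inNbr 1 (S.nodeX a)) r.alpha) -
    S.B a ⬝ᵥ received S.nodeU (S.inNbr 1 (S.nodeX a)) r.gamma - r.zeta a) + δ.beta
  u : r.u = r.gamma + r.theta + δ.u
  x : r.x = S.A.mulVec s.x + S.B.mulVec r.u + δ.x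

namespace IsStep

variable {S : Network N X U Y} {K : ControllerData X U Y} {d : ℕ} {s δ r s' δ' r' : Signals K}

theorem closedLoopStep (S : Network N X U Y) (d : ℕ) (s δ : Signals K) :
    IsStep S K d s δ (closedLoopStep S K d s δ) := by
  constructor <;> rfl

/-- The equations of a pass determine its result, since they can be solved in order. -/
theorem eq_closedLoopStep (h : IsStep S K d s δ r) : r = _root_.closedLoopStep S K d s δ := by
  obtain ⟨y, p, q, wHat, vHat, wTilde, vTilde, lam, xi, alphaHat, zetaHat, gammaHat,
    thetaHat, alpha, gamma, zeta, theta, beta, u, x⟩ := r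
  obtain ⟨h1, h2, h3, h4, h5, h6, h7, h8, h9, h10, h11, h12, h13, h14, h15, h16, h17, h18, h19,
    h20⟩ := h
  dsimp only at h1 h2 h3 h4 h5 h6 h7 h8 h9 h10 h11 h12 h13 h14 h15 h16 h17 h18 h19 h20
  subst h1 h2 h3 h4 h5 h6 h7 h8 h9 h10 h11 h12 h13 h14 h15 h16 h17 h18 h19 h20
  rfl

theorem add (h : IsStep S K d s δ r) (h' : IsStep S K d s' δ' r') :
    IsStep S K d (s + s') (δ + δ') (r + r') := by
  constructor
  case y => simp only [Signals.add_eq, h.y, h'.y, Matrix.mulVec_add]; abel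
  case p =>
    simp only [Signals.add_eq, h.p, h'.p, received_add, Matrix.mulVec_add, Pi.add_apply]
    ext; simp only [Pi.add_apply]; ring
  case q =>
    simp only [Signals.add_eq, h.q, h'.q, received_add, Matrix.mulVec_add, Pi.add_apply]
    ext; simp only [Pi.add_apply]; ring
  case wHat =>
    simp only [Signals.add_eq, h.wHat, h'.wHat, dotProduct_add, Pi.add_apply]
    ext; simp only [Pi.add_apply]; ring
  case vHat =>
    simp only [Signals.add_eq, h.vHat, h'.vHat, dotProduct_add, Pi.add_apply]
    ext; simp only [Pi.add_apply]; ring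
  case wTilde =>
    simp only [Signals.add_eq, h.wTilde, h'.wTilde, received_add, dotProduct_add, Pi.add_apply]
    ext; simp only [Pi.add_apply]; ring
  case vTilde =>
    simp only [Signals.add_eq, h.vTilde, h'.vTilde, received_add, dotProduct_add, Pi.add_apply]
    ext; simp only [Pi.add_apply]; ring
  case lam =>
    simp only [Signals.add_eq, h.lam, h'.lam, Matrix.mulVec_add, Pi.add_apply, add_smul]
    ext; simp only [Pi.add_apply]; ring
  case xi =>
    simp only [Signals.add_eq, h.xi, h'.xi, Matrix.mulVec_add, Pi.add_apply, add_smul]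
    ext; simp only [Pi.add_apply]; ring
  case alphaHat =>
    simp only [Signals.add_eq, h.alphaHat, h'.alphaHat, Matrix.mulVec_add, Pi.add_apply]
    ext; simp only [Pi.add_apply]; ring
  case zetaHat =>
    simp only [Signals.add_eq, h.zetaHat, h'.zetaHat, Matrix.mulVec_add, Pi.add_apply]
    ext; simp only [Pi.add_apply]; ring
  case gammaHat =>
    simp only [Signals.add_eq, h.gammaHat, h'.gammaHat, Matrix.mulVec_add, Pi.add_apply]
    ext; simp only [Pi.add_apply]; ring
  case thetaHat =>
    simp only [Signals.add_eq, h.thetaHat, h'.thetaHat, Matrix.mulVec_add, Pi.add_apply]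
    ext; simp only [Pi.add_apply]; ring
  case alpha =>
    simp only [Signals.add_eq, h.alpha, h'.alpha, received_add_apply, Pi.add_apply,
      Finset.sum_add_distrib]
    ext; simp only [Pi.add_apply]; ring
  case gamma =>
    simp only [Signals.add_eq, h.gamma, h'.gamma, received_add_apply, Pi.add_apply,
      Finset.sum_add_distrib]
    ext; simp only [Pi.add_apply]; ring
  case zeta =>
    simp only [Signals.add_eq, h.zeta, h'.zeta, received_add_apply, Pi.add_apply,
      Finset.sum_add_distrib]
    ext; simp only [Pi.add_apply]; ring
  case theta =>
    simp only [Signals.add_eq, h.theta, h'.theta, received_add_apply, Pi.add_apply,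
      Finset.sum_add_distrib]
    ext; simp only [Pi.add_apply]; ring
  case beta =>
    simp only [Signals.add_eq, h.beta, h'.beta, received_add, dotProduct_add, Pi.add_apply]
    ext; simp only [Pi.add_apply]; ring
  case u => simp only [Signals.add_eq, h.u, h'.u]; abel
  case x => simp only [Signals.add_eq, h.x, h'.x, Matrix.mulVec_add]; abel

theorem smul (k : ℝ) (h : IsStep S K d s δ r) : IsStep S K d (k • s) (k • δ) (k • r) := by
  constructor
  case y => simp only [Signals.smul_eq, h.y, Matrix.mulVec_smul, smul_add]
  case p =>
    simp only [Signals.smul_eq, h.p, received_smul, Matrix.mulVec_smul, Pi.smul_apply]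
    ext; simp only [Pi.add_apply, Pi.smul_apply, smul_eq_mul]; ring
  case q =>
    simp only [Signals.smul_eq, h.q, received_smul, Matrix.mulVec_smul, Pi.smul_apply]
    ext; simp only [Pi.add_apply, Pi.smul_apply, smul_eq_mul]; ring
  case wHat =>
    simp only [Signals.smul_eq, h.wHat, dotProduct_smul, Pi.smul_apply]
    ext; simp only [Pi.add_apply, Pi.smul_apply, smul_eq_mul]; ring
  case vHat =>
    simp only [Signals.smul_eq, h.vHat, dotProduct_smul, Pi.smul_apply]
    ext; simp only [Pi.add_apply, Pi.smul_apply, smul_eq_mul]; ring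
  case wTilde =>
    simp only [Signals.smul_eq, h.wTilde, received_smul, dotProduct_smul, Pi.smul_apply]
    ext; simp only [Pi.add_apply, Pi.smul_apply, smul_eq_mul]; ring
  case vTilde =>
    simp only [Signals.smul_eq, h.vTilde, received_smul, dotProduct_smul, Pi.smul_apply]
    ext; simp only [Pi.add_apply, Pi.smul_apply, smul_eq_mul]; ring
  case lam =>
    simp only [Signals.smul_eq, h.lam, Matrix.mulVec_smul, Pi.smul_apply]
    ext; simp only [Pi.add_apply, Pi.smul_apply, smul_eq_mul]; ring
  case xi =>
    simp only [Signals.smul_eq, h.xi, Matrix.mulVec_smul, Pi.smul_apply]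
    ext; simp only [Pi.add_apply, Pi.smul_apply, smul_eq_mul]; ring
  case alphaHat =>
    simp only [Signals.smul_eq, h.alphaHat, Matrix.mulVec_smul, Pi.smul_apply]
    ext; simp only [Pi.add_apply, Pi.smul_apply, smul_eq_mul]; ring
  case zetaHat =>
    simp only [Signals.smul_eq, h.zetaHat, Matrix.mulVec_smul, Pi.smul_apply]
    ext; simp only [Pi.add_apply, Pi.smul_apply, smul_eq_mul]; ring
  case gammaHat =>
    simp only [Signals.smul_eq, h.gammaHat, Matrix.mulVec_smul, Pi.smul_apply]
    ext; simp only [Pi.add_apply, Pi.smul_apply, smul_eq_mul]; ring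
  case thetaHat =>
    simp only [Signals.smul_eq, h.thetaHat, Matrix.mulVec_smul, Pi.smul_apply]
    ext; simp only [Pi.add_apply, Pi.smul_apply, smul_eq_mul]; ring
  case alpha =>
    simp only [Signals.smul_eq, h.alpha, received_mul_apply, Pi.smul_apply, smul_eq_mul,
      ← Finset.mul_sum]
    ext; simp only [Pi.add_apply, Pi.smul_apply, smul_eq_mul]; ring
  case gamma =>
    simp only [Signals.smul_eq, h.gamma, received_mul_apply, Pi.smul_apply, smul_eq_mul,
      ← Finset.mul_sum]
    ext; simp only [Pi.add_apply, Pi.smul_apply, smul_eq_mul]; ring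
  case zeta =>
    simp only [Signals.smul_eq, h.zeta, received_mul_apply, Pi.smul_apply, smul_eq_mul,
      ← Finset.mul_sum]
    ext; simp only [Pi.add_apply, Pi.smul_apply, smul_eq_mul]; ring
  case theta =>
    simp only [Signals.smul_eq, h.theta, received_mul_apply, Pi.smul_apply, smul_eq_mul,
      ← Finset.mul_sum]
    ext; simp only [Pi.add_apply, Pi.smul_apply, smul_eq_mul]; ring
  case beta =>
    simp only [Signals.smul_eq, h.beta, received_smul, dotProduct_smul, Pi.smul_apply]
    ext; simp only [Pi.add_apply, Pi.smul_apply, smul_eq_mul]; ring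
  case u => simp only [Signals.smul_eq, h.u, smul_add]
  case x => simp only [Signals.smul_eq, h.x, Matrix.mulVec_smul, smul_add]

end IsStep

variable (S : Network N X U Y) (K : ControllerData X U Y) (d : ℕ)

/-- One unperturbed pass, as an operator on the space of all signals. -/
noncomputable def freeStep : Signals K →L[ℝ] Signals K :=
  LinearMap.toContinuousLinearMap
    { toFun := fun s => closedLoopStep S K d s 0
      map_add' := fun s s' => by
        simpa using (((IsStep.closedLoopStep S d s 0).add
          (IsStep.closedLoopStep S d s' 0)).eq_closedLoopStep).symm
      map_smul' := fun k s => by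
        simpa using (((IsStep.closedLoopStep S d s 0).smul k).eq_closedLoopStep).symm }

/-- The response of one pass to the perturbations entering in it. -/
noncomputable def perturbationStep : Signals K →L[ℝ] Signals K :=
  LinearMap.toContinuousLinearMap
    { toFun := fun δ => closedLoopStep S K d 0 δ
      map_add' := fun δ δ' => by
        simpa using (((IsStep.closedLoopStep S d 0 δ).add
          (IsStep.closedLoopStep S d 0 δ')).eq_closedLoopStep).symm
      map_smul' := fun k δ => by
        simpa using (((IsStep.closedLoopStep S d 0 δ).smul k).eq_closedLoopStep).symm }

theorem closedLoopStep_eq (s δ : Signals K) :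
    closedLoopStep S K d s δ = freeStep S K d s + perturbationStep S K d δ := by
  have h := ((IsStep.closedLoopStep S d s 0).add
    (IsStep.closedLoopStep S d 0 δ)).eq_closedLoopStep
  rw [add_zero, zero_add] at h
  exact h.symm

/-- Variation of constants. -/
theorem closedLoop_eq (x0 : X → ℝ) (δ : ℕ → Signals K) (t : ℕ) :
    closedLoop S K d x0 δ t = (freeStep S K d ^ t) (closedLoop S K d x0 δ 0) +
      ∑ i ∈ Finset.range t, (freeStep S K d ^ (t - (i + 1))) (perturbationStep S K d (δ i)) := by
  induction t with
  | zero => simp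
  | succ t ih =>
    have h1 : closedLoop S K d x0 δ (t + 1) =
        closedLoopStep S K d (closedLoop S K d x0 δ t) (δ t) := rfl
    have h2 : ∀ i ∈ Finset.range t,
        (freeStep S K d ^ (t + 1 - (i + 1))) (perturbationStep S K d (δ i)) =
        freeStep S K d ((freeStep S K d ^ (t - (i + 1))) (perturbationStep S K d (δ i))) := by
      intro i hi
      rw [show t + 1 - (i + 1) = t - (i + 1) + 1 by have := Finset.mem_range.1 hi; omega, pow_succ']
      rfl
    rw [h1, closedLoopStep_eq, ih, map_add, map_sum, Finset.sum_range_succ, Finset.sum_congr rfl h2,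
      Nat.sub_self, pow_zero, pow_succ', add_assoc]
    rfl

variable {S K d}

/-! ### Internal stability -/

/-- Every unperturbed run tends to zero, even if it starts from inconsistent values. -/
theorem tendsto_freeStep_pow [DecidableEq X] (hstable : K.Stable) (hSF : K.SFFeasible S)
    (hKF : K.KFFeasible S) (hd : K.MapsLocalized S d) (s : Signals K) :
    Filter.Tendsto (fun t : ℕ => (freeStep S K d ^ t) s) Filter.atTop (nhds 0) := by
  -- after the first pass the static equations hold, whatever `s` is
  have htraj : IsTrajectory S K d (fun t => (freeStep S K d ^ (t + 1)) s)
      (fun _ => 0) (fun _ => 0) :=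
    IsTrajectory.of_step (Or.inr ⟨s, rfl⟩) fun t => by
      rw [pow_succ']
      rfl
  obtain ⟨hp, hq, hw, hv, hl, hxi, hb, hx⟩ := htraj.tendsto_zero hstable hSF hKF hd
  -- a pass reads only these eight signals of the previous one
  set core : ℕ → Signals K := fun t =>
    let r := (freeStep S K d ^ (t + 1)) s
    { (Signals.zero : Signals K) with
      p := r.p, q := r.q, wHat := r.wHat, vHat := r.vHat, lam := r.lam, xi := r.xi,
      beta := r.beta, x := r.x } with hcore
  have h1 : Filter.Tendsto core Filter.atTop (nhds 0) := by
    rw [tendsto_zero_iff_norm_tendsto_zero]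
    have := (((((((hp.norm.add hq.norm).add hw.norm).add hv.norm).add hl.norm).add hxi.norm).add
      hb.norm).add hx.norm)
    simp only [norm_zero, add_zero] at this
    refine this.congr fun t => ?_
    simp [Signals.norm_eq_size, Signals.size, hcore, Signals.zero]
  have h2 := ((freeStep S K d).continuous.tendsto 0).comp h1
  rw [map_zero] at h2
  rw [← Filter.tendsto_add_atTop_iff_nat 2]
  refine h2.congr fun t => ?_
  rw [show t + 2 = (t + 1) + 1 from rfl, pow_succ']
  rfl

theorem internallyStabilizes [DecidableEq X] (hstable : K.Stable) (hSF : K.SFFeasible S)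
    (hKF : K.KFFeasible S) (hd : K.MapsLocalized S d) : InternallyStabilizes S K d := by
  obtain ⟨c, ρ, hc, hρ, hρ1, hM⟩ := exists_norm_pow_le_of_tendsto_zero (freeStep S K d)
    (tendsto_freeStep_pow hstable hSF hKF hd)
  set P := perturbationStep S K d
  refine ⟨c * (1 + ‖P‖), ρ, hρ, hρ1, fun x0 δ t => ?_⟩
  have hx0 : ‖closedLoop S K d x0 δ 0‖ = ‖x0‖ := by
    simp [Signals.norm_eq_size, Signals.size, closedLoop, Signals.zero]
  have hP := norm_nonneg P
  rw [← Signals.norm_eq_size, closedLoop_eq, mul_add]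
  refine (norm_add_le _ _).trans (add_le_add ?_ ?_)
  · refine ((freeStep S K d ^ t).le_opNorm _).trans ?_
    rw [hx0, ← mul_assoc]
    refine mul_le_mul_of_nonneg_right ((hM t).trans ?_) (norm_nonneg _)
    exact mul_le_mul_of_nonneg_right (le_mul_of_one_le_right hc (by linarith)) (by positivity)
  · rw [Finset.mul_sum]
    refine (norm_sum_le _ _).trans (Finset.sum_le_sum fun i _ => ?_)
    rw [← Signals.norm_eq_size]
    calc ‖(freeStep S K d ^ (t - (i + 1))) (P (δ i))‖
        ≤ (c * ρ ^ (t - (i + 1))) * (‖P‖ * ‖δ i‖) :=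
          ((freeStep S K d ^ (t - (i + 1))).le_opNorm _).trans
            (mul_le_mul (hM _) (P.le_opNorm _) (norm_nonneg _) (by positivity))
      _ ≤ (c * ρ ^ (t - (i + 1))) * ((1 + ‖P‖) * ‖δ i‖) := by gcongr; linarith
      _ = c * (1 + ‖P‖) * (ρ ^ (t - (i + 1)) * ‖δ i‖) := by ring

end Linear

/-! ### Localization of the closed-loop maps -/

/-- Localization of a transfer matrix. -/
def Network.TransferLocalized {N X U Y R Q : Type*} (S : Network N X U Y) (row : R → N)
    (col : Q → N) (d : ℕ) (G : Matrix R Q (PowerSeries ℝ)) : Prop :=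
  ∀ r c, col c ∉ S.inNbr d (row r) → G r c = 0

namespace Network.TransferLocalized

variable {N X U Y R Q P : Type*} {S : Network N X U Y} {row : R → N} {mid : P → N} {col : Q → N}
  {d d' : ℕ}

theorem of_kernel {G : ℕ → Matrix R Q ℝ} (h : S.Localized row col d G) :
    S.TransferLocalized row col d (transfer G) := by
  intro r c hc
  ext k
  simpa [transfer] using h k r c hc

theorem mono {G : Matrix R Q (PowerSeries ℝ)} (h : S.TransferLocalized row col d G) (hd : d ≤ d') :
    S.TransferLocalized row col d' G :=
  fun r c hc => h r c fun hc' => hc (S.inNbr_mono hd _ hc')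

theorem add {G H : Matrix R Q (PowerSeries ℝ)} (hG : S.TransferLocalized row col d G)
    (hH : S.TransferLocalized row col d H) : S.TransferLocalized row col d (G + H) :=
  fun r c hc => by rw [Matrix.add_apply, hG r c hc, hH r c hc, add_zero]

theorem sub {G H : Matrix R Q (PowerSeries ℝ)} (hG : S.TransferLocalized row col d G)
    (hH : S.TransferLocalized row col d H) : S.TransferLocalized row col d (G - H) :=
  fun r c hc => by rw [Matrix.sub_apply, hG r c hc, hH r c hc, sub_zero]

theorem smul {G : Matrix R Q (PowerSeries ℝ)} (f : PowerSeries ℝ)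
    (hG : S.TransferLocalized row col d G) : S.TransferLocalized row col d (f • G) :=
  fun r c hc => by rw [Matrix.smul_apply, hG r c hc, smul_zero]

theorem one [DecidableEq Q] : S.TransferLocalized col col 0 1 :=
  fun r c hc => Matrix.one_apply_ne fun h => hc (by rw [h]; rfl)

theorem mul [Fintype P] {G : Matrix R P (PowerSeries ℝ)} {H : Matrix P Q (PowerSeries ℝ)}
    (hG : S.TransferLocalized row mid d G) (hH : S.TransferLocalized mid col d' H) :
    S.TransferLocalized row col (d + d') (G * H) := by
  intro r c hc
  refine Finset.sum_eq_zero fun p _ => ?_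
  change G r p * H p c = 0
  by_cases hp : mid p ∈ S.inNbr d (row r)
  · rw [hH p c fun h => hc (S.mem_inNbr_add hp h), mul_zero]
  · rw [hG r p hp, zero_mul]

theorem gain_A : S.TransferLocalized S.nodeX S.nodeX 1 (gain S.A) := fun r c hc => by
  change PowerSeries.C (S.A r c) = 0
  rw [not_imp_comm.1 S.mem_inNbr_one_of_A hc, map_zero]

end Network.TransferLocalized

section Localization

variable {N X U Y : Type*} [Fintype X] [Fintype U] [Fintype Y] [DecidableEq X]
  {S : Network N X U Y} {K : ControllerData X U Y} {d : ℕ}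

/-- The response to an impulse which enters through the column `b` of the transfer matrix `E` and
is estimated through the column `b` of `G`. -/
theorem coeff_plant_eq_zero {Q : Type*} [Fintype Q] [DecidableEq Q] {d' : ℕ}
    {s : ℕ → Signals K} {w : ℕ → X → ℝ} {v : ℕ → Y → ℝ}
    (h : IsTrajectory S K d s w v) (h0 : s 0 = Signals.zero)
    (hSF : K.SFFeasible S) (hKF : K.KFFeasible S) (hd : K.MapsLocalized S d)
    (hd' : K.MapsLocalized S d') {own : Q → N} {E G : Matrix X Q (PowerSeries ℝ)}
    (hE : S.TransferLocalized S.nodeX own 0 E) (hG : S.TransferLocalized S.nodeX own d' G) {b : Q}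
    (hw : series w = E.mulVec (Pi.single b 1))
    (hg : (transfer K.kfW).mulVec (series w) + (transfer K.kfV).mulVec (series v) =
      G.mulVec (Pi.single b 1)) :
    (∀ a, own b ∉ S.inNbr (2 * d' + 2) (S.nodeX a) → ∀ k, (s k).x a = 0) ∧
      ∀ a, own b ∉ S.inNbr (2 * d' + 2) (S.nodeU a) → ∀ k, (s k).u a = 0 := by
  obtain ⟨hx, hu⟩ := h.plant_response h0 hSF hKF hd hg.symm rfl
  set T : Matrix X Q (PowerSeries ℝ) := 𝕫 • E +
    𝕫 • (gain S.A * G) - G with hT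
  have hr : 𝕫 • series w + 𝕫 •
      (gain S.A).mulVec (G.mulVec (Pi.single b 1)) - G.mulVec (Pi.single b 1) =
      T.mulVec (Pi.single b 1) := by
    rw [hT, hw, Matrix.sub_mulVec, Matrix.add_mulVec, Matrix.smul_mulVec, Matrix.smul_mulVec,
      Matrix.mulVec_mulVec]
  have hTl : S.TransferLocalized S.nodeX own (1 + d') T :=
    (((hE.mono (by omega)).smul _).add ((Network.TransferLocalized.gain_A.mul hG).smul _)).sub
      (hG.mono (by omega))
  rw [hr, Matrix.mulVec_mulVec, Matrix.mulVec_single_one] at hx hu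
  rw [Matrix.mulVec_single_one] at hx
  have hX := (Network.TransferLocalized.of_kernel (S := S) (row := S.nodeX) (col := S.nodeX)
    (d := d') (G := fun k => K.sfX (k + 1)) fun k => hd'.1 (k + 1)).mul hTl
  have hU := (Network.TransferLocalized.of_kernel (S := S) (row := S.nodeU) (col := S.nodeX)
    (d := d') (G := fun k => K.sfU (k + 1)) fun k => hd'.2.1 (k + 1)).mul hTl
  refine ⟨fun a ha k => ?_, fun a ha k => ?_⟩
  · have h1 : (s k).x a = PowerSeries.coeff k (series (fun t => (s t).x) a) := by simp [series]
    rw [h1, hx, Pi.add_apply, Matrix.col_apply, Matrix.col_apply,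
      (hX.mono (by omega)) a b ha, (hG.mono (by omega)) a b ha, add_zero, map_zero]
  · have h1 : (s k).u a = PowerSeries.coeff k (series (fun t => (s t).u) a) := by simp [series]
    rw [h1, hu, Pi.smul_apply, Matrix.col_apply, (hU.mono (by omega)) a b ha, smul_zero, map_zero]

theorem series_impulse {ι : Type*} [DecidableEq ι] (b : ι) :
    series (fun t => if t = 0 then Pi.single b 1 else 0) = Pi.single b 1 := by
  ext i t
  by_cases ht : t = 0 <;> by_cases hi : i = b <;>
    simp [series, ht, hi, PowerSeries.coeff_one]

theorem closedLoopLocalized [DecidableEq Y] (hSF : K.SFFeasible S) (hKF : K.KFFeasible S)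
    (hd : K.MapsLocalized S d) {d' : ℕ} (hd' : K.MapsLocalized S d') :
    ClosedLoopLocalized S K d (2 * d' + 2) := by
  have hW := fun b => coeff_plant_eq_zero (d' := d') (own := S.nodeX) (b := b)
    (s := closedLoop S K d 0 (impulseW K b)) (w := fun t => if t = 0 then Pi.single b 1 else 0)
    (v := fun _ => 0) (E := 1) (G := transfer K.kfW)
    (IsTrajectory.of_step (Or.inl rfl) fun t => by cases t <;> rfl) rfl hSF hKF hd hd'
    Network.TransferLocalized.one (.of_kernel hd'.2.2.1)
    (by rw [series_impulse, Matrix.one_mulVec])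
    (by rw [series_impulse, series_zero, Matrix.mulVec_zero, add_zero])
  have hV := fun b => coeff_plant_eq_zero (d' := d') (own := S.nodeY) (b := b)
    (s := closedLoop S K d 0 (impulseV K b)) (w := fun _ => 0)
    (v := fun t => if t = 0 then Pi.single b 1 else 0) (E := 0) (G := transfer K.kfV)
    (IsTrajectory.of_step (Or.inl rfl) fun t => by cases t <;> rfl) rfl hSF hKF hd hd'
    (fun _ _ _ => rfl) (.of_kernel hd'.2.2.2)
    (by rw [series_zero, Matrix.zero_mulVec])
    (by rw [series_impulse, series_zero, Matrix.mulVec_zero, zero_add])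
  exact ⟨fun k a b hb => (hW b).1 a hb k, fun k a b hb => (hV b).1 a hb k,
    fun k a b hb => (hW b).2 a hb (k + 1), fun k a b hb => (hV b).2 a hb (k + 1)⟩

end Localization

theorem theorem5 {N X U Y : Type*} [Fintype X] [Fintype U] [Fintype Y]
    [DecidableEq X] [DecidableEq Y]
    (S : Network N X U Y) (K : ControllerData X U Y) (d : ℕ)
    (hstable : K.Stable) (hSF : K.SFFeasible S) (hKF : K.KFFeasible S)
    (hd : K.MapsLocalized S d) :
    InternallyStabilizes S K d ∧
      ∀ d' : ℕ, K.MapsLocalized S d' → ClosedLoopLocalized S K d (2 * d' + 2) :=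
  ⟨internallyStabilizes hstable hSF hKF hd, fun _ hd' => closedLoopLocalized hSF hKF hd hd'⟩
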